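/- Let $G$ be a directed acyclic graph on $V=\{1,\dots,p\}$ with edge set $E$ such that $i<j$ for every edge $(i,j)\in E$. For $a=(a_{ij})_{(i,j)\in E}\in\mathbb{R}^{E}$ let $A$ be the strictly upper triangular $p\times p$ matrix with entries $a_{ij}$ for $(i,j)\in E$ and $0$ elsewhere, and let $K=K(a)=(A-I)(A-I)^T$, the concentration matrix of the Gaussian vector $X$ with $X=A^TX+\epsilon$, $\epsilon\sim\mathcal N(0,I)$. For $S\subseteq V$ and distinct $i,j\in V\setminus S$ put $R=V\setminus(S\cup\{i,j\})$; the absolute value of the partial correlation is $$|\operatorname{corr}(i,j\mid S)|=\frac{|\det K_{iR,jR}|}{\sqrt{\det K_{iR,iR}\cdot\det K_{jR,jR}}},\qquad iR=\{i\}\cup R,\quad jR=\{j\}\cup R.$$ The vertices $i$ and $j$ are d-separated given $S$ if $\det K_{iR,jR}=0$ for all $a\in\mathbb{R}^E$. Let $V_G(\lambda)$ be the probability, for $a$ uniformly distributed on $[-1,1]^{E}$, that $|\operatorname{corr}(i,j\mid S)|\le\lambda$ for at least one triple $(i,j,S)$ as above for which $i$ and $j$ are not d-separated given $S$ (that is,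 that the distribution is not $\lambda$-strong-faithful to $G$). Let $\mathrm{Chain}_p$ be the graph with edges $(k,k+1)$, $1\le k\le p-1$, and $\mathrm{Star}_p$ the graph with edges $(1,k)$, $2\le k\le p$; in both cases $[-1,1]^E=[-1,1]^{p-1}$. Then, as $\lambda\to0^+$, $$V_{\mathrm{Chain}_p}(\lambda)\sim\frac{1}{(p-2)!}\,\lambda\,(-\ln\lambda)^{p-2}\quad(p\ge2),\qquad V_{\mathrm{Star}_p}(\lambda)\sim\binom p3\,\lambda\,(-\ln\lambda)\quad(p\ge3),$$ where $f\sim g$ means $f(\lambda)/g(\lambda)\to1$. That is, the leading constants are $C_{\rm chain}=1/(p-2)!$ and $C_{\rm star}=\binom p3$. -/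

import Mathlib

open Real Filter Topology MeasureTheory Asymptotics

/-- A directed acyclic graph on the vertices `0, …, p - 1`, numbered in a topological order
(every edge goes from a smaller to a larger vertex). -/
structure OrderedDAG (p : ℕ) where
  /-- `Adj i j` says that `i → j` is an edge. -/
  Adj : Fin p → Fin p → Prop
  lt_of_adj : ∀ i j, Adj i j → i < j

namespace OrderedDAG

/-- The directed edges of `G`. -/
def Edge {p : ℕ} (G : OrderedDAG p) : Type := {e : Fin p × Fin p // G.Adj e.1 e.2}

instance {p : ℕ} (G : OrderedDAG p) : Finite G.Edge :=
  inferInstanceAs (Finite {e : Fin p × Fin p // G.Adj e.1 e.2})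

noncomputable instance {p : ℕ} (G : OrderedDAG p) : Fintype G.Edge := Fintype.ofFinite _

open Classical in
/-- The weighted adjacency matrix: entry `a i j` on an edge `i → j`, and `0` elsewhere. -/
noncomputable def weightMatrix {p : ℕ} (G : OrderedDAG p) (a : G.Edge → ℝ) :
    Matrix (Fin p) (Fin p) ℝ :=
  Matrix.of fun i j => if h : G.Adj i j then a ⟨(i, j), h⟩ else 0

/-- The concentration matrix `K = (A - I) (A - I)ᵀ` of the Gaussian vector `X` that solves
`X = Aᵀ X + ε`, where `ε` is standard Gaussian. -/
noncomputable def concentration {p : ℕ} (G : OrderedDAG p) (a : G.Edge → ℝ) :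
    Matrix (Fin p) (Fin p) ℝ :=
  (G.weightMatrix a - 1) * (G.weightMatrix a - 1).transpose

/-- The set `R = V \ (S ∪ {i, j})`. -/
def rest {p : ℕ} (i j : Fin p) (S : Finset (Fin p)) : Finset (Fin p) :=
  Finset.univ \ (S ∪ {i, j})

/-- The minor `det K_{iR, jR}`. The rows are `i` followed by `R`, the columns are `j` followed
by `R`, with the same order of `R` in both; `none` stands for `i`, respectively `j`. -/
noncomputable def minor {p : ℕ} (K : Matrix (Fin p) (Fin p) ℝ) (i j : Fin p)
    (R : Finset (Fin p)) : ℝ :=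
  (K.submatrix (fun o : Option R => o.elim i Subtype.val)
    (fun o : Option R => o.elim j Subtype.val)).det

/-- The partial correlation `corr(i, j | S)`, for distinct `i, j ∉ S`. With the order of rows and
columns that is fixed in `minor` the sign is the one of the partial correlation (for `R = ∅` it
is `-K i j / √(K i i * K j j)`); only the absolute value is used below. -/
noncomputable def partialCorr {p : ℕ} (G : OrderedDAG p) (a : G.Edge → ℝ) (i j : Fin p)
    (S : Finset (Fin p)) : ℝ :=
  -minor (G.concentration a) i j (rest i j S) /
    √(minor (G.concentration a) i i (rest i j S) * minor (G.concentration a) j j (rest i j S))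

/-- `i` and `j` are d-separated given `S`: the almost-principal minor `det K_{iR, jR}`
(equivalently, the partial correlation) vanishes for all parameters `a ∈ ℝ^E`. -/
def DSeparated {p : ℕ} (G : OrderedDAG p) (i j : Fin p) (S : Finset (Fin p)) : Prop :=
  ∀ a : G.Edge → ℝ, minor (G.concentration a) i j (rest i j S) = 0

/-- The parameter space `Ω = [-1, 1]^E`. -/
def cube {p : ℕ} (G : OrderedDAG p) : Set (G.Edge → ℝ) := {a | ∀ e, a e ∈ Set.Icc (-1) 1}

/-- The tube of all `a ∈ Ω` with `|corr(i, j | S)| ≤ t`. -/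
def tube {p : ℕ} (G : OrderedDAG p) (i j : Fin p) (S : Finset (Fin p)) (t : ℝ) :
    Set (G.Edge → ℝ) :=
  {a ∈ G.cube | |G.partialCorr a i j S| ≤ t}

/-- The union of the tubes of all triples `(i, j, S)`, with `i ≠ j` outside `S`, that are not
d-separated: the parameters of the distributions that are not `t`-strong-faithful. -/
def unfaithfulRegion {p : ℕ} (G : OrderedDAG p) (t : ℝ) : Set (G.Edge → ℝ) :=
  {a | ∃ (i j : Fin p) (S : Finset (Fin p)),
    i ≠ j ∧ i ∉ S ∧ j ∉ S ∧ ¬ G.DSeparated i j S ∧ a ∈ G.tube i j S t}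

/-- The uniform probability measure on the cube `Ω`. -/
noncomputable def uniformPrior {p : ℕ} (G : OrderedDAG p) : Measure (G.Edge → ℝ) :=
  ProbabilityTheory.cond volume G.cube

/-- The volume `V_G(t)` of the `t`-strong-unfaithful distributions, for the uniform prior. -/
noncomputable def unfaithfulVolume {p : ℕ} (G : OrderedDAG p) (t : ℝ) : ℝ :=
  G.uniformPrior.real (G.unfaithfulRegion t)

/-- The chain `1 → 2 → ⋯ → p`. -/
def chain (p : ℕ) : OrderedDAG p where
  Adj i j := i.val + 1 = j.val
  lt_of_adj i j h := by rw [Fin.lt_def]; omega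

/-- The star, with an edge from the first vertex to every other vertex. -/
def star (p : ℕ) : OrderedDAG p where
  Adj i j := i.val = 0 ∧ 0 < j.val
  lt_of_adj i j h := by rw [Fin.lt_def]; omega

end OrderedDAG

/-!
A tube `|corr(i, j | S)| ≤ t` is cut out by `|det K_{iR, jR}| ≤ t √(det K_{iR, iR} det K_{jR, jR})`.
The principal minors are positive, because `K` is positive definite. For the chain and the star the
off-diagonal minor, where it does not vanish identically, is up to sign a positive continuous
function times a product of distinct edge weights. So each tube has the form
`{a | ∏_{e ∈ s} |a e| ≤ t h(a)}` with `h` continuous and positive.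

For `n` independent uniform variables on `[0, 1]` the product is at most `t` with probability
`t ∑_{k < n} (-ln t)^k / k!` (`measureReal_absProd_le`), of order `t (-ln t)^(n - 1)`. Most of this
mass lies where all factors are small on every fixed scale. Hence only the values of `h` at points
whose coordinates in `s` vanish matter for the leading term, and, since these values depend only on
the coordinates outside `s`, only their mean:
the volume of the tube is asymptotic to `E[h] t (-ln t)^(n - 1) / (n - 1)!`
(`tendsto_measureReal_absProd_le_mul`). Two tubes for different sets `s` of the same size meet in a
set of lower order (`tendsto_measureReal_inter`), so that leading terms add up, and tubes with fewer
factors are negligible (`tendsto_measureReal_region`).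

* For the chain, the product runs over the edges of the path from `i` to `j`
  (`OrderedDAG.chain_abs_minor`). It has `p - 1` factors only if `i` and `j` are the two ends and
  `S` is empty. For this triple `h = 1` at the origin, which gives `1 / (p - 2)!`.
* For the star, two leaves `i`, `j` with the centre not in `S` give `|a_i a_j|`
  (`OrderedDAG.star_abs_minor_leaf`), while the centre and a leaf give one factor only. For fixed
  leaves the tubes increase with `S`, so that only the largest `S` counts. There `h` has the value
  `1 + ∑_{k ≠ i, j} a_k²` on `a_i = a_j = 0`, whose mean is `1 + (p - 3) / 3 = p / 3`. Summation
  over the `(p - 1).choose 2` pairs of leaves gives `p.choose 3`.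
-/

namespace StrongFaithfulness

open ProbabilityTheory

/-! ### The uniform distribution on the cube -/

/-- The uniform probability measure on `[-1, 1]`. -/
noncomputable def uniformInterval : Measure ℝ := cond volume (Set.Icc (-1) 1)

instance : IsProbabilityMeasure uniformInterval :=
  cond_isProbabilityMeasure_of_finite (by simp) (by simp)

/-- The law of `|x|`, for `x` uniform on `[-1, 1]`, is uniform on `[0, 1]`. -/
lemma integral_uniformInterval_comp_abs (g : ℝ → ℝ) :
    ∫ y, g |y| ∂uniformInterval = ∫ z in (0 : ℝ)..1, g z := by
  have h1 : ∫ y in Set.Icc (-1 : ℝ) 1, g |y| = ∫ y, (Set.Iic (1 : ℝ)).indicator g |y| := by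
    rw [← integral_indicator measurableSet_Icc]
    congr 1
    ext y
    by_cases hy : |y| ≤ 1
    · rw [Set.indicator_of_mem (Set.mem_Icc.2 (abs_le.1 hy)),
        Set.indicator_of_mem (Set.mem_Iic.2 hy)]
    · rw [Set.indicator_of_notMem (fun h => hy (abs_le.2 (Set.mem_Icc.1 h))),
        Set.indicator_of_notMem (s := Set.Iic (1 : ℝ)) hy]
  have h2 : (volume (Set.Icc (-1 : ℝ) 1)).toReal = 2 := by
    rw [Real.volume_Icc]; norm_num
  rw [uniformInterval, ProbabilityTheory.cond, integral_smul_measure, h1, integral_comp_abs,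
    setIntegral_indicator measurableSet_Iic, ENNReal.toReal_inv, h2,
    intervalIntegral.integral_of_le zero_le_one, Set.Ioi_inter_Iic, smul_eq_mul]
  ring

lemma ae_uniformInterval : ∀ᵐ y ∂uniformInterval, y ∈ Set.Icc (-1 : ℝ) 1 :=
  ae_cond_mem measurableSet_Icc

/-- The product of the absolute values of the coordinates in `s`. -/
def absProd {ι : Type*} (s : Finset ι) (x : ι → ℝ) : ℝ := ∏ i ∈ s, |x i|

lemma absProd_nonneg {ι : Type*} (s : Finset ι) (x : ι → ℝ) : 0 ≤ absProd s x :=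
  Finset.prod_nonneg fun _ _ => abs_nonneg _

lemma absProd_le_one {ι : Type*} (s : Finset ι) {x : ι → ℝ} (hx : ∀ i, x i ∈ Set.Icc (-1 : ℝ) 1) :
    absProd s x ≤ 1 :=
  Finset.prod_le_one (fun _ _ => abs_nonneg _) fun i _ => abs_le.2 (hx i)

@[fun_prop]
lemma measurable_absProd {ι : Type*} (s : Finset ι) : Measurable (absProd s) := by
  unfold absProd; fun_prop

/-- The uniform probability measure on `[-1, 1]^ι`. -/
noncomputable def uniformCube (ι : Type*) [Fintype ι] : Measure (ι → ℝ) :=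
  Measure.pi fun _ => uniformInterval

variable {ι : Type*} [Fintype ι]

instance : IsProbabilityMeasure (uniformCube ι) := by
  unfold uniformCube; infer_instance

lemma ae_uniformCube : ∀ᵐ x ∂uniformCube ι, ∀ i, x i ∈ Set.Icc (-1 : ℝ) 1 := by
  rw [eventually_countable_forall]
  intro i
  exact (measurePreserving_eval (fun _ : ι => uniformInterval) i).quasiMeasurePreserving.ae
    ae_uniformInterval

lemma integral_sq_uniformCube (i : ι) :
    ∫ x, x i ^ 2 ∂uniformCube ι = 1 / 3 := by
  have h : ∫ x, x i ^ 2 ∂uniformCube ι = ∫ y, |y| ^ 2 ∂uniformInterval := by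
    simp only [sq_abs]
    exact integral_comp_eval (μ := fun _ : ι => uniformInterval) (f := fun y : ℝ => y ^ 2)
      (by fun_prop)
  rw [h, integral_uniformInterval_comp_abs fun z => z ^ 2, integral_pow]
  norm_num

lemma integrable_sq_uniformCube (i : ι) :
    Integrable (fun x : ι → ℝ => x i ^ 2) (uniformCube ι) := by
  have hm : Measurable fun x : ι → ℝ => x i ^ 2 := by fun_prop
  refine Integrable.of_bound hm.aestronglyMeasurable 1 ?_
  filter_upwards [ae_uniformCube] with x hx
  rw [norm_pow, Real.norm_eq_abs]
  exact pow_le_one₀ (abs_nonneg _) (abs_le.2 (hx i))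

lemma iIndepFun_abs : iIndepFun (fun (i : ι) (x : ι → ℝ) => |x i|) (uniformCube ι) :=
  iIndepFun_pi (X := fun _ : ι => fun y : ℝ => |y|) fun _ => by fun_prop

lemma indepFun_absProd_abs {s : Finset ι} {i : ι} (hi : i ∉ s) :
    IndepFun (absProd s) (fun x : ι → ℝ => |x i|) (uniformCube ι) := by
  have := iIndepFun_abs (ι := ι).indepFun_finsetProd_of_notMem (fun i => by fun_prop) hi
  convert this using 1
  ext x
  simp [absProd]

/-- Fubini's theorem for the joint law of two independent random variables. -/
lemma measureReal_of_indepFun {Ω α β : Type*} [MeasurableSpace Ω] [MeasurableSpace α]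
    [MeasurableSpace β] {P : Measure Ω} [IsProbabilityMeasure P] {Y : Ω → α} {Z : Ω → β}
    (hY : Measurable Y) (hZ : Measurable Z) (hYZ : IndepFun Y Z P) {B : Set (α × β)}
    (hB : MeasurableSet B) :
    P.real {ω | (Y ω, Z ω) ∈ B} = ∫ ω, P.real {ω' | (Y ω', Z ω) ∈ B} ∂P := by
  have h := (indepFun_iff_map_prod_eq_prod_map_map hY.aemeasurable hZ.aemeasurable).1 hYZ
  have : IsProbabilityMeasure (P.map Y) := Measure.isProbabilityMeasure_map hY.aemeasurable
  have : IsProbabilityMeasure (P.map Z) := Measure.isProbabilityMeasure_map hZ.aemeasurable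
  have h1 : P {ω | (Y ω, Z ω) ∈ B} = ∫⁻ ω, P {ω' | (Y ω', Z ω) ∈ B} ∂P := by
    have e1 : P {ω | (Y ω, Z ω) ∈ B} = P.map (fun ω => (Y ω, Z ω)) B :=
      (Measure.map_apply (hY.prodMk hZ) hB).symm
    rw [e1, h, Measure.prod_apply_symm hB, lintegral_map (measurable_measure_prodMk_right hB) hZ]
    refine lintegral_congr fun ω => ?_
    rw [Measure.map_apply hY (measurable_prodMk_right hB)]
    rfl
  have hm : Measurable fun ω => P {ω' | (Y ω', Z ω) ∈ B} := by
    have e : (fun ω => P {ω' | (Y ω', Z ω) ∈ B})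
        = (fun z => P.map Y ((fun y => (y, z)) ⁻¹' B)) ∘ Z := by
      ext ω
      rw [Function.comp, Measure.map_apply hY (measurable_prodMk_right hB)]
      rfl
    rw [e]
    exact (measurable_measure_prodMk_right hB).comp hZ
  simp only [measureReal_def]
  rw [integral_toReal hm.aemeasurable (ae_of_all _ fun _ => measure_lt_top _ _), h1]

/-! ### The law of a product of uniform variables -/

/-- The distribution function, on `(0, 1)`, of a product of `n` independent variables that are
uniform on `[0, 1]`. -/
noncomputable def logSum (n : ℕ) (t : ℝ) : ℝ :=
  t * ∑ k ∈ Finset.range n, (-log t) ^ k / (k.factorial : ℝ)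

/-- The recursion for the distribution function when one more uniform factor is added. -/
lemma integral_logSum_div (n : ℕ) {t : ℝ} (h0 : 0 < t) (h1 : t < 1) :
    ∫ z in t..1, logSum n (t / z) = logSum (n + 1) t - t := by
  have hd : ∀ z ∈ Set.uIcc t 1, HasDerivAt
      (fun z => ∑ k ∈ Finset.range n, t * ((log z - log t) ^ (k + 1) / ((k + 1).factorial : ℝ)))
      (logSum n (t / z)) z := by
    intro z hz
    rw [Set.uIcc_of_le h1.le] at hz
    have hz0 : 0 < z := h0.trans_le hz.1
    have : logSum n (t / z) = ∑ k ∈ Finset.range n,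
        t * ((((k + 1 : ℕ) : ℝ) * (log z - log t) ^ k * z⁻¹) / ((k + 1).factorial : ℝ)) := by
      rw [logSum, Finset.mul_sum, log_div h0.ne' hz0.ne', neg_sub]
      refine Finset.sum_congr rfl fun k _ => ?_
      rw [Nat.factorial_succ]
      push_cast
      have := Nat.factorial_ne_zero k
      field_simp
    rw [this]
    refine HasDerivAt.fun_sum fun k _ => ?_
    have := ((((hasDerivAt_log hz0.ne').sub_const (log t)).fun_pow (k + 1)).div_const
      ((k + 1).factorial : ℝ)).const_mul t
    simpa using this
  have hc : ContinuousOn (fun z => logSum n (t / z)) (Set.uIcc t 1) := by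
    rw [Set.uIcc_of_le h1.le]
    unfold logSum
    have hz : ∀ z ∈ Set.Icc t 1, z ≠ 0 := fun z hz => (h0.trans_le hz.1).ne'
    have hz' : ∀ z ∈ Set.Icc t 1, t / z ≠ 0 := fun z h => div_ne_zero h0.ne' (hz z h)
    have hdiv : ContinuousOn (fun z : ℝ => t / z) (Set.Icc t 1) :=
      continuousOn_const.div continuousOn_id hz
    exact hdiv.mul (continuousOn_finsetSum _ fun k _ =>
      ((hdiv.log hz').neg.pow k).div_const _)
  rw [intervalIntegral.integral_eq_sub_of_hasDerivAt hd hc.intervalIntegrable]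
  simp only [logSum, Finset.sum_range_succ' _ n, log_one, zero_sub, sub_self]
  simp [Finset.mul_sum, mul_add]

/-- The induction conditions on the new factor `z`: the bound is automatic if `z ≤ t`, and otherwise
the other factors have to satisfy it with `t / z < 1`. -/
lemma measureReal_absProd_le [DecidableEq ι] (s : Finset ι) {t : ℝ} (h0 : 0 < t) (h1 : t < 1) :
    (uniformCube ι).real {x | absProd s x ≤ t} = logSum s.card t := by
  induction s using Finset.induction_on generalizing t with
  | empty => simp [absProd, logSum, h1.not_ge]
  | insert i s hi ih =>
    have hind := indepFun_absProd_abs hi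
    have hB : MeasurableSet {q : ℝ × ℝ | q.1 * q.2 ≤ t} :=
      measurableSet_le (by fun_prop) (by fun_prop)
    have e1 : {x : ι → ℝ | absProd (insert i s) x ≤ t}
        = {x | (absProd s x, |x i|) ∈ {q : ℝ × ℝ | q.1 * q.2 ≤ t}} := by
      ext x
      simp [absProd, Finset.prod_insert hi, mul_comm]
    rw [e1, measureReal_of_indepFun (by fun_prop) (by fun_prop) hind hB]
    set g : ℝ → ℝ := fun z => (uniformCube ι).real {x | absProd s x * z ≤ t} with hg
    have hgm : Measurable g := by
      have : IsProbabilityMeasure ((uniformCube ι).map (absProd s)) :=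
        Measure.isProbabilityMeasure_map (by fun_prop)
      have h := measurable_measure_prodMk_right (μ := (uniformCube ι).map (absProd s)) hB
      have e : g = fun z => ((uniformCube ι).map (absProd s)
          ((fun y => (y, z)) ⁻¹' {q : ℝ × ℝ | q.1 * q.2 ≤ t})).toReal := by
        ext z
        rw [Measure.map_apply (by fun_prop) (measurable_prodMk_right hB)]
        rfl
      rw [e]
      exact h.ennreal_toReal
    have e2 : ∫ x, g |x i| ∂uniformCube ι = ∫ z in (0 : ℝ)..1, g z := by
      rw [← integral_uniformInterval_comp_abs]
      exact integral_comp_eval (μ := fun _ : ι => uniformInterval) (f := fun y => g |y|)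
        (hgm.comp (by fun_prop)).aestronglyMeasurable
    change ∫ x, g |x i| ∂uniformCube ι = _
    rw [e2]
    have hg1 : ∀ z, g z ≤ 1 := fun z => measureReal_le_one
    have hint : ∀ a b : ℝ, IntervalIntegrable g volume a b := fun a b => by
      refine (intervalIntegrable_const (c := (1 : ℝ))).mono_fun hgm.aestronglyMeasurable
        (ae_of_all _ fun z => ?_)
      beta_reduce
      rw [norm_of_nonneg (show 0 ≤ g z from measureReal_nonneg), norm_one]
      exact hg1 z
    rw [← intervalIntegral.integral_add_adjacent_intervals (hint 0 t) (hint t 1)]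
    have i1 : ∫ z in (0 : ℝ)..t, g z = t := by
      have : ∀ z ∈ Set.uIcc 0 t, g z = 1 := by
        intro z hz
        rw [Set.uIcc_of_le h0.le] at hz
        have : (Set.univ : Set (ι → ℝ)) ≤ᵐ[uniformCube ι] {x | absProd s x * z ≤ t} := by
          filter_upwards [ae_uniformCube] with x hx _
          exact (mul_le_of_le_one_left hz.1 (absProd_le_one s hx)).trans hz.2
        have h := measure_mono_ae this
        rw [measure_univ] at h
        simp [hg, measureReal_def, le_antisymm prob_le_one h]
      rw [intervalIntegral.integral_congr this]
      simp
    have i2 : ∫ z in t..1, g z = ∫ z in t..1, logSum s.card (t / z) := by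
      refine intervalIntegral.integral_congr_ae (ae_of_all _ fun z hz => ?_)
      rw [Set.uIoc_of_le h1.le] at hz
      have hz0 : 0 < z := h0.trans hz.1
      rw [← ih (div_pos h0 hz0) ((div_lt_one hz0).2 hz.1)]
      simp only [hg, le_div_iff₀ hz0]
    rw [i1, i2, integral_logSum_div _ h0 h1, Finset.card_insert_of_notMem hi]
    ring

/-! ### Asymptotics of the distribution function of a product -/

lemma tendsto_neg_log_atTop : Tendsto (fun t : ℝ => -log t) (𝓝[>] 0) atTop :=
  tendsto_neg_atBot_atTop.comp tendsto_log_nhdsGT_zero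

/-- The scale `t (-ln t) ^ m` of the asymptotic formulas. -/
noncomputable def logScale (m : ℕ) (t : ℝ) : ℝ := t * (-log t) ^ m

lemma eventually_logScale_pos (m : ℕ) : ∀ᶠ t in 𝓝[>] (0 : ℝ), 0 < logScale m t := by
  filter_upwards [self_mem_nhdsWithin, tendsto_neg_log_atTop.eventually_gt_atTop 0] with t h0 hL
  exact mul_pos h0 (pow_pos hL m)

lemma tendsto_logSum {n m : ℕ} (hn : n ≤ m + 1) {c : ℝ} (hc : 0 < c) :
    Tendsto (fun t => logSum n (c * t) / logScale m t) (𝓝[>] 0)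
      (𝓝 (if n = m + 1 then c / (m.factorial : ℝ) else 0)) := by
  have hL := tendsto_neg_log_atTop
  have hquot : Tendsto (fun t : ℝ => 1 - log c * (-log t)⁻¹) (𝓝[>] 0) (𝓝 1) := by
    simpa using tendsto_const_nhds.sub ((tendsto_inv_atTop_zero.comp hL).const_mul (log c))
  have hterm : ∀ k ∈ Finset.range n, Tendsto (fun t : ℝ => (1 - log c * (-log t)⁻¹) ^ k *
      ((-log t) ^ k / (-log t) ^ m) / (k.factorial : ℝ)) (𝓝[>] 0)
      (𝓝 (if k = m then 1 / (k.factorial : ℝ) else 0)) := by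
    intro k hk
    have hkm : k ≤ m := by have := Finset.mem_range.1 hk; omega
    rcases hkm.lt_or_eq with h | rfl
    · rw [if_neg h.ne]
      simpa using ((hquot.pow k).mul ((tendsto_pow_div_pow_atTop_zero h).comp hL)).div_const
        (k.factorial : ℝ)
    · rw [if_pos rfl]
      refine Tendsto.div_const ?_ _
      have : Tendsto (fun t : ℝ => (-log t) ^ k / (-log t) ^ k) (𝓝[>] 0) (𝓝 1) := by
        refine tendsto_const_nhds.congr' ?_
        filter_upwards [hL.eventually_gt_atTop 0] with t ht
        rw [div_self (pow_pos ht k).ne']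
      simpa using (hquot.pow k).mul this
  have hsum := (tendsto_finsetSum _ hterm).const_mul c
  have hlim : c * ∑ k ∈ Finset.range n, (if k = m then 1 / (k.factorial : ℝ) else 0)
      = if n = m + 1 then c / (m.factorial : ℝ) else 0 := by
    rw [Finset.sum_ite_eq']
    by_cases h : n = m + 1
    · rw [if_pos h, if_pos (by simp [h]), mul_one_div]
    · rw [if_neg h, if_neg (by simp; omega), mul_zero]
  rw [hlim] at hsum
  refine hsum.congr' ?_
  filter_upwards [self_mem_nhdsWithin, hL.eventually_gt_atTop 0] with t h0 hLt
  have h0 : 0 < t := h0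
  rw [logSum, logScale, log_mul hc.ne' h0.ne', mul_assoc, mul_div_assoc,
    mul_div_mul_left _ _ h0.ne', Finset.sum_div]
  congr 1
  refine Finset.sum_congr rfl fun k _ => ?_
  have hl : log t ≠ 0 := by rintro h; simp [h] at hLt
  have : (-(log c + log t)) ^ k = (1 - log c * (-log t)⁻¹) ^ k * (-log t) ^ k := by
    rw [← mul_pow]; congr 1; field_simp; ring
  rw [this]
  ring

lemma isEquivalent_of_tendsto_div {f g : ℝ → ℝ} {l : Filter ℝ} {c : ℝ} (hc : c ≠ 0)
    (h : Tendsto (fun t => f t / g t) l (𝓝 c)) : f ~[l] fun t => c * g t := by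
  refine isEquivalent_of_tendsto_one ?_
  have h1 := h.div_const c
  rw [div_self hc] at h1
  refine h1.congr fun t => ?_
  rw [Pi.div_apply, div_div, mul_comm]

lemma tendsto_sum_zero {α κ : Type*} {l : Filter α} (F : Finset κ) {f : κ → α → ℝ}
    (hf : ∀ k ∈ F, Tendsto (f k) l (𝓝 0)) : Tendsto (fun a => ∑ k ∈ F, f k a) l (𝓝 0) := by
  simpa using tendsto_finsetSum F hf

lemma tendsto_measureReal_absProd_le (s : Finset ι) {m : ℕ} (hs : s.card ≤ m + 1)
    {c : ℝ} (hc : 0 < c) :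
    Tendsto (fun t => (uniformCube ι).real {x | absProd s x ≤ c * t} / logScale m t) (𝓝[>] 0)
      (𝓝 (if s.card = m + 1 then c / (m.factorial : ℝ) else 0)) := by
  classical
  refine (tendsto_logSum hs hc).congr' ?_
  filter_upwards [Ioo_mem_nhdsGT (inv_pos.2 hc)] with t ht
  rw [measureReal_absProd_le s (mul_pos hc ht.1)]
  calc c * t < c * c⁻¹ := by gcongr; exact ht.2
    _ = 1 := mul_inv_cancel₀ hc.ne'

open Classical in
/-- The point `x` with the coordinates in `s` replaced by `0`. -/
noncomputable def zeroOn {ι : Type*} (s : Finset ι) (x : ι → ℝ) : ι → ℝ :=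
  fun i => if i ∈ s then 0 else x i

@[fun_prop]
lemma continuous_zeroOn {ι : Type*} (s : Finset ι) : Continuous (zeroOn s) := by
  unfold zeroOn
  refine continuous_pi fun i => ?_
  split_ifs <;> fun_prop

lemma zeroOn_mem {ι : Type*} (s : Finset ι) {x : ι → ℝ} (hx : ∀ i, x i ∈ Set.Icc (-1 : ℝ) 1)
    (i : ι) :
    zeroOn s x i ∈ Set.Icc (-1 : ℝ) 1 := by
  unfold zeroOn
  split_ifs
  · simp
  · exact hx i

lemma isCompact_cube {ι : Type*} : IsCompact {x : ι → ℝ | ∀ i, x i ∈ Set.Icc (-1 : ℝ) 1} := by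
  have : {x : ι → ℝ | ∀ i, x i ∈ Set.Icc (-1 : ℝ) 1} = Set.univ.pi fun _ => Set.Icc (-1 : ℝ) 1 := by
    ext x; simp only [Set.mem_ofPred_eq, Set.mem_univ_pi]
  rw [this]
  exact isCompact_univ_pi fun _ => isCompact_Icc

/-- A continuous function has a positive upper bound on the cube. -/
lemma exists_bound {ι : Type*} {h : (ι → ℝ) → ℝ} (hc : Continuous h) :
    ∃ M, 0 < M ∧ ∀ x : ι → ℝ, (∀ i, x i ∈ Set.Icc (-1 : ℝ) 1) → h x ≤ M := by
  obtain ⟨M, hM⟩ := isCompact_cube.bddAbove_image hc.continuousOn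
  exact ⟨max M 1, by positivity, fun x hx => (hM ⟨x, hx, rfl⟩).trans (le_max_left _ _)⟩

/-- `h (zeroOn s x)` is a function of the coordinates outside `s`. -/
lemma indepFun_absProd_zeroOn (s : Finset ι) {h : (ι → ℝ) → ℝ} (hc : Continuous h) :
    IndepFun (absProd s) (fun x => h (zeroOn s x)) (uniformCube ι) := by
  classical
  have hi : iIndepFun (fun (i : ι) (x : ι → ℝ) => x i) (uniformCube ι) :=
    iIndepFun_pi (X := fun _ : ι => fun y : ℝ => y) fun _ => by fun_prop
  have h1 := hi.indepFun_finset s sᶜ disjoint_compl_right (fun i => by fun_prop)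
  have h2 := h1.comp (φ := fun y : s → ℝ => ∏ i, |y i|)
    (ψ := fun y : ↥(sᶜ) → ℝ => h fun i => if hi : i ∈ s then 0 else y ⟨i, Finset.mem_compl.2 hi⟩)
    (by fun_prop) (hc.measurable.comp (measurable_pi_lambda _ fun i => by
      split_ifs <;> fun_prop))
  convert h2 using 1
  · ext x
    simp only [absProd, Function.comp]
    exact (Finset.prod_coe_sort s fun i => |x i|).symm
  · ext x
    exact congrArg h (funext fun i => by by_cases hi : i ∈ s <;> simp [zeroOn, hi])

/-- If the threshold depends on the coordinates outside `s` only, then it is independent of the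
product over `s`, and only its mean enters the asymptotic formula. -/
lemma tendsto_measureReal_absProd_le_zeroOn (s : Finset ι) {m : ℕ} (hs : s.card = m + 1)
    {h : (ι → ℝ) → ℝ} (hc : Continuous h) (hpos : ∀ x, 0 < h x) :
    Tendsto (fun t => (uniformCube ι).real {x | absProd s x ≤ t * h (zeroOn s x)} / logScale m t)
      (𝓝[>] 0) (𝓝 ((∫ x, h (zeroOn s x) ∂uniformCube ι) / (m.factorial : ℝ))) := by
  obtain ⟨M, hM0, hM⟩ := exists_bound hc
  set G : ℝ → ℝ := fun u => (uniformCube ι).real {x | absProd s x ≤ u} with hG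
  have hGmono : Monotone G := fun u v huv => measureReal_mono fun x hx => le_trans hx huv
  have e1 : ∀ t, (uniformCube ι).real {x | absProd s x ≤ t * h (zeroOn s x)} / logScale m t
      = ∫ x, G (t * h (zeroOn s x)) / logScale m t ∂uniformCube ι := by
    intro t
    rw [integral_div]
    congr 1
    exact measureReal_of_indepFun (by fun_prop) (hc.comp (continuous_zeroOn s)).measurable
      (indepFun_absProd_zeroOn s hc) (B := {q | q.1 ≤ t * q.2})
      (measurableSet_le (by fun_prop) (by fun_prop))
  simp_rw [e1]
  rw [← integral_div]
  have hlim := tendsto_measureReal_absProd_le s hs.le hM0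
  rw [if_pos hs] at hlim
  refine tendsto_integral_filter_of_dominated_convergence (fun _ => M / (m.factorial : ℝ) + 1)
    ?_ ?_ (integrable_const _) ?_
  · refine Eventually.of_forall fun t => Measurable.aestronglyMeasurable ?_
    exact (hGmono.measurable.comp
      (((hc.comp (continuous_zeroOn s)).measurable).const_mul t)).div_const _
  · filter_upwards [hlim.eventually_le_const (lt_add_one _), eventually_logScale_pos m,
      self_mem_nhdsWithin] with t ht hsc h0
    filter_upwards [ae_uniformCube] with x hx
    rw [norm_of_nonneg (div_nonneg measureReal_nonneg hsc.le)]
    refine le_trans ?_ ht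
    refine div_le_div_of_nonneg_right (hGmono ?_) hsc.le
    rw [mul_comm]
    exact mul_le_mul_of_nonneg_right (hM _ (zeroOn_mem s hx)) (le_of_lt h0)
  · refine ae_of_all _ fun x => ?_
    have := tendsto_measureReal_absProd_le s hs.le (hpos (zeroOn s x))
    rw [if_pos hs] at this
    simpa only [hG, mul_comm] using this

lemma absProd_eq_mul_erase {ι : Type*} [DecidableEq ι] {s : Finset ι} {i : ι} (hi : i ∈ s)
    (x : ι → ℝ) :
    absProd s x = |x i| * absProd (s.erase i) x :=
  (Finset.mul_prod_erase s _ hi).symm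

/-- Off the `δ`-neighbourhood of `{x i = 0}`, a small product over `s` forces a small product over
`s \ {i}`. -/
lemma absProd_erase_le {ι : Type*} [DecidableEq ι] {s : Finset ι} {i : ι} (hi : i ∈ s)
    {x : ι → ℝ} {δ u : ℝ} (hδ : 0 < δ) (hx : δ < |x i|) (h : absProd s x ≤ u) :
    absProd (s.erase i) x ≤ u / δ := by
  rw [le_div_iff₀ hδ, mul_comm]
  refine le_trans ?_ h
  rw [absProd_eq_mul_erase hi]
  exact mul_le_mul_of_nonneg_right hx.le (absProd_nonneg _ _)

/-- Most of the mass of `{∏_{i ∈ s} |x i| ≤ t h(x)}` is carried by points whose coordinates in `s`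
are all small. The threshold `h` may therefore be frozen at the value `0` of these coordinates. -/
theorem tendsto_measureReal_absProd_le_mul (s : Finset ι) {m : ℕ} (hs : s.card = m + 1)
    {h : (ι → ℝ) → ℝ} (hc : Continuous h) (hpos : ∀ x, 0 < h x) :
    Tendsto (fun t => (uniformCube ι).real {x | absProd s x ≤ t * h x} / logScale m t)
      (𝓝[>] 0) (𝓝 ((∫ x, h (zeroOn s x) ∂uniformCube ι) / (m.factorial : ℝ))) := by
  classical
  obtain ⟨M, hM0, hM⟩ := exists_bound hc
  set I := (∫ x, h (zeroOn s x) ∂uniformCube ι) / (m.factorial : ℝ)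
  -- The contribution of the points with a large coordinate in `s` is of lower order.
  have herr : ∀ δ > 0, Tendsto (fun t => ∑ i ∈ s,
      (uniformCube ι).real {x | absProd (s.erase i) x ≤ M / δ * t} / logScale m t)
      (𝓝[>] 0) (𝓝 0) := by
    intro δ hδ
    refine tendsto_sum_zero s fun i hi => ?_
    have hcard : (s.erase i).card = m := by rw [Finset.card_erase_of_mem hi, hs]; rfl
    have := tendsto_measureReal_absProd_le (s.erase i) (m := m) (by omega) (div_pos hM0 hδ)
    rwa [if_neg (by omega)] at this
  -- Uniform continuity: near the coordinate subspace, `h` is close to its value there.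
  have hnear : ∀ ε > 0, ∃ δ > 0, ∀ x : ι → ℝ, (∀ i, x i ∈ Set.Icc (-1 : ℝ) 1) →
      (∀ i ∈ s, |x i| ≤ δ) → |h x - h (zeroOn s x)| ≤ ε * h (zeroOn s x) := by
    intro ε hε
    obtain ⟨x₀, -, hx₀⟩ := (isCompact_cube (ι := ι)).exists_isMinOn ⟨0, fun i => by simp⟩
      hc.continuousOn
    have hu := (isCompact_cube (ι := ι)).uniformContinuousOn_of_continuous hc.continuousOn
    obtain ⟨δ, hδ, hd⟩ := Metric.uniformContinuousOn_iff.1 hu (ε * h x₀) (mul_pos hε (hpos x₀))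
    refine ⟨δ / 2, by positivity, fun x hx hxs => ?_⟩
    have hdist : dist x (zeroOn s x) < δ := by
      refine lt_of_le_of_lt ((dist_pi_le_iff (by positivity)).2 fun i => ?_) (half_lt_self hδ)
      by_cases hi : i ∈ s
      · simpa [zeroOn, hi] using hxs i hi
      · simp [zeroOn, hi]; positivity
    have h1 := hd x hx _ (zeroOn_mem s hx) hdist
    rw [Real.dist_eq] at h1
    refine h1.le.trans ?_
    gcongr
    exact hx₀ (zeroOn_mem s hx)
  -- Comparison of two thresholds that are ordered where all coordinates in `s` are small.
  have hcomp : ∀ (g₁ g₂ : (ι → ℝ) → ℝ) (δ t : ℝ), 0 < δ → 0 < t → 0 < logScale m t →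
      (∀ x : ι → ℝ, (∀ i, x i ∈ Set.Icc (-1 : ℝ) 1) → g₁ x ≤ M) →
      (∀ x : ι → ℝ, (∀ i, x i ∈ Set.Icc (-1 : ℝ) 1) → (∀ i ∈ s, |x i| ≤ δ) → g₁ x ≤ g₂ x) →
      (uniformCube ι).real {x | absProd s x ≤ t * g₁ x} / logScale m t ≤
        (uniformCube ι).real {x | absProd s x ≤ t * g₂ x} / logScale m t + ∑ i ∈ s,
          (uniformCube ι).real {x | absProd (s.erase i) x ≤ M / δ * t} / logScale m t := by
    intro g₁ g₂ δ t hδ ht hsc hgM hle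
    rw [← Finset.sum_div, ← add_div]
    gcongr
    refine le_trans ?_ ((measureReal_union_le _ _).trans
      (add_le_add_right (measureReal_biUnion_finset_le s _) _))
    refine ENNReal.toReal_mono (measure_ne_top _ _) (measure_mono_ae ?_)
    filter_upwards [ae_uniformCube] with x hx (hxp : absProd s x ≤ t * g₁ x)
    change x ∈ (_ ∪ _ : Set (ι → ℝ))
    by_cases hsm : ∀ i ∈ s, |x i| ≤ δ
    · left
      exact hxp.trans (mul_le_mul_of_nonneg_left (hle x hx hsm) ht.le)
    · right
      push Not at hsm
      obtain ⟨i, hi, hxi⟩ := hsm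
      refine Set.mem_biUnion hi ?_
      have := absProd_erase_le hi hδ hxi (hxp.trans (mul_le_mul_of_nonneg_left (hgM x hx) ht.le))
      rwa [mul_div_assoc, mul_comm] at this
  have hfrozen : ∀ r > 0, Tendsto (fun t =>
      (uniformCube ι).real {x | absProd s x ≤ t * (r * h (zeroOn s x))} / logScale m t)
      (𝓝[>] 0) (𝓝 (r * I)) := by
    intro r hr
    have := tendsto_measureReal_absProd_le_zeroOn s hs (hc.const_mul r)
      (fun x => mul_pos hr (hpos x))
    rwa [integral_const_mul, mul_div_assoc] at this
  refine tendsto_order.2 ⟨fun a ha => ?_, fun a ha => ?_⟩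
  · have hcont : Tendsto (fun ε : ℝ => (1 - ε) * I) (𝓝[>] 0) (𝓝 I) := by
      refine tendsto_nhdsWithin_of_tendsto_nhds ?_
      have : Continuous fun ε : ℝ => (1 - ε) * I := by fun_prop
      simpa using this.tendsto 0
    obtain ⟨ε, hεa, hε0, hε1⟩ := ((hcont.eventually_const_lt ha).and
      (Ioo_mem_nhdsGT zero_lt_one)).exists
    obtain ⟨δ, hδ, hd⟩ := hnear ε hε0
    have h1 : Tendsto _ _ _ := (hfrozen (1 - ε) (by linarith)).sub (herr δ hδ)
    rw [sub_zero] at h1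
    filter_upwards [h1.eventually_const_lt hεa, self_mem_nhdsWithin, eventually_logScale_pos m]
      with t ht ht0 hsc
    have := hcomp (fun x => (1 - ε) * h (zeroOn s x)) h δ t hδ ht0 hsc
      (fun x hx => (mul_le_of_le_one_left (hpos _).le (by linarith)).trans
        (hM _ (zeroOn_mem s hx)))
      (fun x hx hxs => by have := (abs_le.1 (hd x hx hxs)).1; linarith)
    linarith
  · have hcont : Tendsto (fun ε : ℝ => (1 + ε) * I) (𝓝[>] 0) (𝓝 I) := by
      refine tendsto_nhdsWithin_of_tendsto_nhds ?_
      have : Continuous fun ε : ℝ => (1 + ε) * I := by fun_prop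
      simpa using this.tendsto 0
    obtain ⟨ε, hεa, hε0, hε1⟩ := ((hcont.eventually_lt_const ha).and
      (Ioo_mem_nhdsGT zero_lt_one)).exists
    obtain ⟨δ, hδ, hd⟩ := hnear ε hε0
    have h1 : Tendsto _ _ _ := (hfrozen (1 + ε) (by linarith)).add (herr δ hδ)
    rw [add_zero] at h1
    filter_upwards [h1.eventually_lt_const hεa, self_mem_nhdsWithin, eventually_logScale_pos m]
      with t ht ht0 hsc
    have := hcomp h (fun x => (1 + ε) * h (zeroOn s x)) δ t hδ ht0 hsc hM
      (fun x hx hxs => by have := (abs_le.1 (hd x hx hxs)).2; linarith)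
    linarith

/-! ### Unions of tubes around products -/

/-- Two tubes for different sets of the same size meet in a set of lower order. -/
lemma tendsto_measureReal_inter {s s' : Finset ι} {m : ℕ} (hs : s.card = m + 1)
    (hs' : s'.card = m + 1) (hne : s ≠ s') {M : ℝ} (hM : 0 < M) :
    Tendsto (fun t => (uniformCube ι).real
      ({x | absProd s x ≤ M * t} ∩ {x | absProd s' x ≤ M * t}) / logScale m t) (𝓝[>] 0) (𝓝 0) := by
  classical
  obtain ⟨i, hi', hi⟩ : ∃ i ∈ s', i ∉ s := by
    by_contra! hcon
    exact hne (Finset.eq_of_subset_of_card_le hcon (by omega)).symm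
  have hcard : (s'.erase i).card = m := by rw [Finset.card_erase_of_mem hi', hs']; rfl
  have hmain := tendsto_measureReal_absProd_le s hs.le hM
  rw [if_pos hs] at hmain
  -- Either `x i` is small, which is independent of the product over `s`, or the product over
  -- `s' \ {i}` is small.
  have hbound : ∀ δ t : ℝ, 0 < δ → δ < 1 → 0 < logScale m t → (uniformCube ι).real
      ({x | absProd s x ≤ M * t} ∩ {x | absProd s' x ≤ M * t}) / logScale m t ≤
      δ * ((uniformCube ι).real {x | absProd s x ≤ M * t} / logScale m t) +
        (uniformCube ι).real {x | absProd (s'.erase i) x ≤ M / δ * t} / logScale m t := by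
    intro δ t hδ hδ1 hsc
    have hind := indepFun_absProd_abs hi
    have h1 := hind.measure_inter_preimage_eq_mul (Set.Iic (M * t)) (Set.Iic δ) measurableSet_Iic
      measurableSet_Iic
    have h2 : (uniformCube ι).real {x | |x i| ≤ δ} = δ := by
      have := measureReal_absProd_le ({i} : Finset ι) hδ hδ1
      simpa [absProd, logSum] using this
    have h3 : (uniformCube ι).real ({x | absProd s x ≤ M * t} ∩ {x | |x i| ≤ δ})
        = δ * (uniformCube ι).real {x | absProd s x ≤ M * t} := by
      rw [mul_comm δ]
      nth_rw 2 [← h2]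
      rw [measureReal_def, measureReal_def, measureReal_def, ← ENNReal.toReal_mul]
      exact congrArg ENNReal.toReal h1
    rw [← mul_div_assoc, ← add_div, ← h3]
    gcongr
    refine le_trans (measureReal_mono ?_) (measureReal_union_le _ _)
    rintro x ⟨hx, hx'⟩
    by_cases hxi : |x i| ≤ δ
    · exact Or.inl ⟨hx, hxi⟩
    · right
      have := absProd_erase_le hi' hδ (not_le.1 hxi) hx'
      rwa [mul_comm, mul_div_assoc, mul_comm] at this
  refine tendsto_order.2 ⟨fun a ha => ?_, fun a ha => ?_⟩
  · filter_upwards [eventually_logScale_pos m] with t ht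
    exact ha.trans_le (div_nonneg measureReal_nonneg ht.le)
  · have hcont : Tendsto (fun δ : ℝ => δ * (M / (m.factorial : ℝ))) (𝓝[>] 0) (𝓝 0) := by
      refine tendsto_nhdsWithin_of_tendsto_nhds ?_
      have : Continuous fun δ : ℝ => δ * (M / (m.factorial : ℝ)) := by fun_prop
      simpa using this.tendsto 0
    obtain ⟨δ, hδa, hδ0, hδ1⟩ := ((hcont.eventually_lt_const ha).and
      (Ioo_mem_nhdsGT zero_lt_one)).exists
    have h2 := tendsto_measureReal_absProd_le (s'.erase i) (m := m) (by omega) (div_pos hM hδ0)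
    rw [if_neg (by omega)] at h2
    have h3 := (hmain.const_mul δ).add h2
    rw [add_zero] at h3
    filter_upwards [h3.eventually_lt_const hδa, eventually_logScale_pos m] with t ht hsc
    exact (hbound δ t hδ0 hδ1 hsc).trans_lt ht

/-- The Bonferroni inequality. -/
lemma sum_measureReal_le {Ω κ : Type*} [MeasurableSpace Ω] [DecidableEq κ] (P : Measure Ω)
    [IsFiniteMeasure P] (F : Finset κ) {A : κ → Set Ω} (hA : ∀ k, MeasurableSet (A k)) :
    ∑ k ∈ F, P.real (A k) ≤
      P.real (⋃ k ∈ F, A k) + ∑ k ∈ F, ∑ l ∈ F.erase k, P.real (A k ∩ A l) := by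
  induction F using Finset.induction_on with
  | empty => simp
  | insert a F ha ih =>
    have h1 := measureReal_union_add_inter (μ := P) (s := A a)
      (F.measurableSet_biUnion fun k _ => hA k)
      (measure_ne_top _ _) (measure_ne_top _ _)
    have h2 : P.real (A a ∩ ⋃ k ∈ F, A k) ≤ ∑ l ∈ F, P.real (A a ∩ A l) := by
      simp only [Set.inter_iUnion]
      exact measureReal_biUnion_finset_le F _
    have h3 : ∑ k ∈ F, ∑ l ∈ F.erase k, P.real (A k ∩ A l)
        ≤ ∑ k ∈ F, ∑ l ∈ (insert a F).erase k, P.real (A k ∩ A l) := by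
      refine Finset.sum_le_sum fun k _ => Finset.sum_le_sum_of_subset_of_nonneg
        (Finset.erase_subset_erase _ (Finset.subset_insert _ _)) fun _ _ _ => measureReal_nonneg
    rw [Finset.set_biUnion_insert, Finset.sum_insert ha, Finset.sum_insert ha,
      Finset.erase_insert ha]
    linarith

/-- A region that agrees, up to tubes around products of at most `m` coordinates, with the union of
the tubes `{∏_{i ∈ s} |x i| ≤ t h_s(x)}` over distinct `(m + 1)`-sets `s`: the leading terms of the
volumes of these tubes add up. -/
theorem tendsto_measureReal_region {m : ℕ} (F : Finset (Finset ι)) (hF : ∀ s ∈ F, s.card = m + 1)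
    {h : Finset ι → (ι → ℝ) → ℝ} (hc : ∀ s, Continuous (h s)) (hpos : ∀ s x, 0 < h s x)
    {U : ℝ → Set (ι → ℝ)} {C : ℝ} (hC : 0 < C)
    (hlower : ∀ t > 0, ∀ x : ι → ℝ, (∀ i, x i ∈ Set.Icc (-1 : ℝ) 1) → ∀ s ∈ F,
      absProd s x ≤ t * h s x → x ∈ U t)
    (hupper : ∀ t > 0, ∀ x : ι → ℝ, (∀ i, x i ∈ Set.Icc (-1 : ℝ) 1) → x ∈ U t →
      (∃ s ∈ F, absProd s x ≤ t * h s x) ∨ ∃ s : Finset ι, s.card ≤ m ∧ absProd s x ≤ C * t) :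
    Tendsto (fun t => (uniformCube ι).real (U t) / logScale m t) (𝓝[>] 0)
      (𝓝 (∑ s ∈ F, (∫ x, h s (zeroOn s x) ∂uniformCube ι) / (m.factorial : ℝ))) := by
  classical
  have hsum := tendsto_finsetSum F fun s hs =>
    tendsto_measureReal_absProd_le_mul s (hF s hs) (hc s) (hpos s)
  choose M hM0 hM using fun s => exists_bound (hc s)
  have hinter : Tendsto (fun t => ∑ s ∈ F, ∑ s' ∈ F.erase s, (uniformCube ι).real
      ({x | absProd s x ≤ t * h s x} ∩ {x | absProd s' x ≤ t * h s' x}) / logScale m t)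
      (𝓝[>] 0) (𝓝 0) := by
    refine tendsto_sum_zero _ fun s hs => tendsto_sum_zero _ fun s' hs' => ?_
    have hMM : 0 < max (M s) (M s') := lt_max_of_lt_left (hM0 s)
    refine tendsto_of_tendsto_of_tendsto_of_le_of_le' tendsto_const_nhds
      (tendsto_measureReal_inter (hF s hs) (hF s' (Finset.mem_of_mem_erase hs'))
        (Finset.ne_of_mem_erase hs').symm hMM) ?_ ?_
    · filter_upwards [eventually_logScale_pos m] with t ht
      exact div_nonneg measureReal_nonneg ht.le
    · filter_upwards [eventually_logScale_pos m, self_mem_nhdsWithin] with t hsc ht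
      have ht : 0 < t := ht
      refine div_le_div_of_nonneg_right
        (ENNReal.toReal_mono (measure_ne_top _ _) (measure_mono_ae ?_)) hsc.le
      filter_upwards [ae_uniformCube] with x hx hxp
      have h1 : absProd s x ≤ t * h s x := hxp.1
      have h2 : absProd s' x ≤ t * h s' x := hxp.2
      rw [mul_comm] at h1 h2
      exact ⟨h1.trans (mul_le_mul_of_nonneg_right ((hM s x hx).trans (le_max_left _ _)) ht.le),
        h2.trans (mul_le_mul_of_nonneg_right ((hM s' x hx).trans (le_max_right _ _)) ht.le)⟩
  have hlow : Tendsto (fun t => ∑ s ∈ Finset.univ.filter (fun s : Finset ι => s.card ≤ m),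
      (uniformCube ι).real {x | absProd s x ≤ C * t} / logScale m t) (𝓝[>] 0) (𝓝 0) := by
    refine tendsto_sum_zero _ fun s hs => ?_
    have hs := (Finset.mem_filter.1 hs).2
    have := tendsto_measureReal_absProd_le s (m := m) (by omega) hC
    rwa [if_neg (by omega)] at this
  have hA : ∀ t s, MeasurableSet {x : ι → ℝ | absProd s x ≤ t * h s x} := fun t s =>
    measurableSet_le (by fun_prop) ((hc s).measurable.const_mul t)
  have lo := hsum.sub hinter
  have up := hsum.add hlow
  rw [sub_zero] at lo
  rw [add_zero] at up
  refine tendsto_of_tendsto_of_tendsto_of_le_of_le' lo up ?_ ?_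
  · filter_upwards [eventually_logScale_pos m, self_mem_nhdsWithin] with t hsc ht
    simp only [← Finset.sum_div, ← sub_div]
    gcongr
    have h1 := sum_measureReal_le (uniformCube ι) F (hA t)
    have h2 : (uniformCube ι).real (⋃ s ∈ F, {x | absProd s x ≤ t * h s x})
        ≤ (uniformCube ι).real (U t) := by
      refine ENNReal.toReal_mono (measure_ne_top _ _) (measure_mono_ae ?_)
      filter_upwards [ae_uniformCube] with x hx hxp
      obtain ⟨s, hs, hxs⟩ := Set.mem_iUnion₂.1 (show x ∈ ⋃ s ∈ F, _ from hxp)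
      exact hlower t ht x hx s hs hxs
    linarith
  · filter_upwards [eventually_logScale_pos m, self_mem_nhdsWithin] with t hsc ht
    simp only [← Finset.sum_div, ← add_div]
    gcongr
    refine le_trans ?_ ((measureReal_union_le _ _).trans (add_le_add
      (measureReal_biUnion_finset_le F _) (measureReal_biUnion_finset_le _ _)))
    refine ENNReal.toReal_mono (measure_ne_top _ _) (measure_mono_ae ?_)
    filter_upwards [ae_uniformCube] with x hx hxU
    change x ∈ (_ ∪ _ : Set (ι → ℝ))
    rcases hupper t ht x hx hxU with ⟨s, hs, hxs⟩ | ⟨s, hs, hxs⟩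
    · exact Or.inl (Set.mem_biUnion hs hxs)
    · exact Or.inr (Set.mem_biUnion (by simpa using hs) hxs)

end StrongFaithfulness

namespace OrderedDAG

open StrongFaithfulness

variable {p : ℕ}

/-! ### The uniform prior and the minors of the concentration matrix -/

section

variable (G : OrderedDAG p)

lemma mem_cube {a : G.Edge → ℝ} : a ∈ G.cube ↔ ∀ e, a e ∈ Set.Icc (-1 : ℝ) 1 := Iff.rfl

lemma uniformPrior_eq : G.uniformPrior = uniformCube G.Edge := by
  have hcube : G.cube = Set.univ.pi fun _ => Set.Icc (-1 : ℝ) 1 := by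
    ext a; simp only [mem_cube, Set.mem_univ_pi]
  have hmeas : MeasurableSet G.cube := by
    rw [hcube]; exact MeasurableSet.univ_pi fun _ => measurableSet_Icc
  symm
  refine Measure.pi_eq fun s hs => ?_
  rw [uniformPrior, ProbabilityTheory.cond_apply hmeas, hcube, ← Set.pi_inter_distrib, volume_pi,
    Measure.pi_pi, Measure.pi_pi, ENNReal.prod_inv_distrib (by simp [Set.Pairwise]),
    ← Finset.prod_mul_distrib]
  exact Finset.prod_congr rfl fun _ _ =>
    (ProbabilityTheory.cond_apply measurableSet_Icc _ _).symm

lemma weightMatrix_of_le (a : G.Edge → ℝ) {u v : Fin p} (h : v ≤ u) : G.weightMatrix a u v = 0 :=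
  dif_neg fun hadj => (G.lt_of_adj u v hadj).not_ge h

lemma concentration_posDef (a : G.Edge → ℝ) : (G.concentration a).PosDef := by
  have htri : (G.weightMatrix a - 1).IsUpperTriangular := fun u v huv => by
    have huv : v < u := huv
    change G.weightMatrix a u v - (1 : Matrix (Fin p) (Fin p) ℝ) u v = 0
    rw [Matrix.one_apply_ne huv.ne', G.weightMatrix_of_le a huv.le, sub_zero]
  have hdet : (G.weightMatrix a - 1).det = (-1) ^ p := by
    rw [Matrix.det_of_isUpperTriangular htri]
    simp [G.weightMatrix_of_le a le_rfl]
  have hunit : IsUnit (G.weightMatrix a - 1) := by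
    rw [Matrix.isUnit_iff_isUnit_det, hdet]
    exact (isUnit_one.neg).pow p
  have := Matrix.PosDef.mul_conjTranspose_self (G.weightMatrix a - 1)
    (Matrix.vecMul_injective_iff_isUnit.2 hunit)
  rwa [Matrix.conjTranspose_eq_transpose_of_trivial] at this

lemma concentration_zero : G.concentration 0 = 1 := by
  have : G.weightMatrix 0 = 0 := by
    ext u v
    simp only [weightMatrix, Matrix.of_apply, Matrix.zero_apply]
    split_ifs <;> rfl
  simp [concentration, this]

lemma concentration_comm (a : G.Edge → ℝ) (u v : Fin p) :
    G.concentration a u v = G.concentration a v u := by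
  simp only [concentration, Matrix.mul_apply, Matrix.transpose_apply]
  exact Finset.sum_congr rfl fun _ _ => mul_comm _ _

@[fun_prop]
lemma continuous_concentration : Continuous G.concentration := by
  have : Continuous G.weightMatrix := by
    refine continuous_matrix fun u v => ?_
    simp only [weightMatrix, Matrix.of_apply]
    split_ifs <;> fun_prop
  unfold concentration
  fun_prop

lemma continuous_minor (i j : Fin p) (R : Finset (Fin p)) :
    Continuous fun a => minor (G.concentration a) i j R := by
  unfold minor
  exact ((G.continuous_concentration).matrix_submatrix _ _).matrix_det

lemma injective_option_elim {i : Fin p} {R : Finset (Fin p)} (hi : i ∉ R) :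
    Function.Injective fun o : Option R => o.elim i Subtype.val := by
  rintro (_ | ⟨u, hu⟩) (_ | ⟨v, hv⟩) h
  · rfl
  · exact absurd ((show i = v from h) ▸ hv) hi
  · exact absurd ((show u = i from h) ▸ hu) hi
  · simpa using h

lemma range_option_elim (i : Fin p) (R : Finset (Fin p)) :
    Set.range (fun o : Option R => o.elim i Subtype.val) = insert i (R : Set (Fin p)) := by
  ext u
  simp only [Set.mem_range, Option.exists, Option.elim_none, Option.elim_some, Set.mem_insert_iff,
    Subtype.exists, exists_prop, Finset.mem_coe, eq_comm (b := u), exists_eq_right']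

/-- Up to sign, the minor may be computed with any enumeration of the rows and of the columns. -/
lemma abs_minor_eq (K : Matrix (Fin p) (Fin p) ℝ) {i j : Fin p} {R : Finset (Fin p)} (hi : i ∉ R)
    (hj : j ∉ R) {κ : Type*} [Fintype κ] [DecidableEq κ] {f g : κ → Fin p}
    (hf : Function.Injective f) (hg : Function.Injective g)
    (hfr : Set.range f = insert i (R : Set (Fin p)))
    (hgr : Set.range g = insert j (R : Set (Fin p))) :
    |minor K i j R| = |(K.submatrix f g).det| := by
  have key : ∀ {i : Fin p} {f : κ → Fin p}, i ∉ R → Function.Injective f →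
      Set.range f = insert i (R : Set (Fin p)) →
      ∃ e : κ ≃ Option R, ∀ k, (e k).elim i Subtype.val = f k := by
    intro i f hi hf hfr
    have hr : Set.range f = Set.range fun o : Option R => o.elim i Subtype.val := by
      rw [hfr, range_option_elim]
    refine ⟨(Equiv.ofInjective f hf).trans ((Equiv.setCongr hr).trans
      (Equiv.ofInjective _ (injective_option_elim hi)).symm), fun k => ?_⟩
    have := Equiv.apply_ofInjective_symm (injective_option_elim hi)
      ((Equiv.setCongr hr) (Equiv.ofInjective f hf k))
    simpa using this
  obtain ⟨e₁, he₁⟩ := key hi hf hfr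
  obtain ⟨e₂, he₂⟩ := key hj hg hgr
  rw [minor, ← Matrix.abs_det_submatrix_equiv_equiv e₁ e₂, Matrix.submatrix_submatrix]
  congr 3
  · exact funext he₁
  · exact funext he₂

lemma minor_comm (a : G.Edge → ℝ) (i j : Fin p) (R : Finset (Fin p)) :
    minor (G.concentration a) i j R = minor (G.concentration a) j i R := by
  rw [minor, minor, ← Matrix.det_transpose, Matrix.transpose_submatrix]
  congr 2
  ext u v
  exact G.concentration_comm a v u

lemma minor_self_pos (a : G.Edge → ℝ) {i : Fin p} {R : Finset (Fin p)} (hi : i ∉ R) :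
    0 < minor (G.concentration a) i i R :=
  ((G.concentration_posDef a).submatrix (injective_option_elim hi)).det_pos

lemma minor_self_zero {i : Fin p} {R : Finset (Fin p)} (hi : i ∉ R) :
    minor (G.concentration 0) i i R = 1 := by
  rw [minor, concentration_zero, Matrix.submatrix_one _ (injective_option_elim hi), Matrix.det_one]

lemma mem_rest {i j u : Fin p} {S : Finset (Fin p)} :
    u ∈ rest i j S ↔ u ∉ S ∧ u ≠ i ∧ u ≠ j := by
  simp only [rest, Finset.mem_sdiff, Finset.mem_univ, Finset.mem_union, Finset.mem_insert,
    Finset.mem_singleton, true_and, not_or, ne_eq]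

lemma left_notMem_rest (i j : Fin p) (S : Finset (Fin p)) : i ∉ rest i j S := by simp [mem_rest]

lemma right_notMem_rest (i j : Fin p) (S : Finset (Fin p)) : j ∉ rest i j S := by simp [mem_rest]

lemma rest_comm (i j : Fin p) (S : Finset (Fin p)) : rest i j S = rest j i S := by
  ext u; simp [mem_rest, and_comm]

/-- The square root of the two principal minors in the denominator of the partial correlation. -/
noncomputable def minorScale (i j : Fin p) (S : Finset (Fin p)) (a : G.Edge → ℝ) : ℝ :=
  √(minor (G.concentration a) i i (rest i j S) * minor (G.concentration a) j j (rest i j S))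

lemma minorScale_pos (i j : Fin p) (S : Finset (Fin p)) (a : G.Edge → ℝ) :
    0 < G.minorScale i j S a :=
  Real.sqrt_pos.2 (mul_pos (G.minor_self_pos a (left_notMem_rest i j S))
    (G.minor_self_pos a (right_notMem_rest i j S)))

lemma minorScale_zero (i j : Fin p) (S : Finset (Fin p)) : G.minorScale i j S 0 = 1 := by
  rw [minorScale, G.minor_self_zero (left_notMem_rest i j S),
    G.minor_self_zero (right_notMem_rest i j S), mul_one, Real.sqrt_one]

lemma continuous_minorScale (i j : Fin p) (S : Finset (Fin p)) :
    Continuous (G.minorScale i j S) :=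
  ((G.continuous_minor i i _).mul (G.continuous_minor j j _)).sqrt

lemma mem_tube {i j : Fin p} {S : Finset (Fin p)} {t : ℝ} {a : G.Edge → ℝ} :
    a ∈ G.tube i j S t ↔
      a ∈ G.cube ∧ |minor (G.concentration a) i j (rest i j S)| ≤ t * G.minorScale i j S a := by
  change _ ∧ |-minor (G.concentration a) i j (rest i j S) / G.minorScale i j S a| ≤ t ↔ _
  rw [abs_div, abs_neg, abs_of_pos (G.minorScale_pos i j S a),
    div_le_iff₀ (G.minorScale_pos i j S a)]

lemma tube_comm (i j : Fin p) (S : Finset (Fin p)) (t : ℝ) : G.tube i j S t = G.tube j i S t := by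
  ext a
  rw [mem_tube, mem_tube, minorScale, minorScale, rest_comm j i, G.minor_comm a j i,
    mul_comm (minor _ j j _)]

lemma dSeparated_comm {i j : Fin p} {S : Finset (Fin p)} :
    G.DSeparated i j S ↔ G.DSeparated j i S := by
  unfold DSeparated
  simp only [rest_comm j i, G.minor_comm _ j i]

lemma unfaithfulVolume_eq (t : ℝ) :
    G.unfaithfulVolume t = (uniformCube G.Edge).real (G.unfaithfulRegion t) := by
  rw [unfaithfulVolume, uniformPrior_eq]

/-- The two endpoints of a triple may be taken in increasing order. -/
lemma mem_unfaithfulRegion {t : ℝ} {a : G.Edge → ℝ} :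
    a ∈ G.unfaithfulRegion t ↔ ∃ (i j : Fin p) (S : Finset (Fin p)),
      i < j ∧ i ∉ S ∧ j ∉ S ∧ ¬ G.DSeparated i j S ∧ a ∈ G.tube i j S t := by
  constructor
  · rintro ⟨i, j, S, hij, hi, hj, hd, ha⟩
    rcases lt_or_gt_of_ne hij with h | h
    · exact ⟨i, j, S, h, hi, hj, hd, ha⟩
    · exact ⟨j, i, S, h, hj, hi, by rwa [dSeparated_comm], by rwa [tube_comm]⟩
  · rintro ⟨i, j, S, hij, h⟩
    exact ⟨i, j, S, hij.ne, h⟩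

end

/-! ### The chain -/

/-- The entries of the factor `A - I` of the concentration matrix vanish below the diagonal. -/
lemma weightMatrix_sub_one_of_lt (G : OrderedDAG p) (a : G.Edge → ℝ) {u v : Fin p} (h : v < u) :
    (G.weightMatrix a - 1) u v = 0 := by
  rw [Matrix.sub_apply, Matrix.one_apply_ne h.ne', G.weightMatrix_of_le a h.le, sub_zero]

lemma chain_weightMatrix_sub_one (a : (chain p).Edge → ℝ) {u v : Fin p} (h : u.val + 1 < v.val) :
    ((chain p).weightMatrix a - 1) u v = 0 := by
  have huv : u ≠ v := by rintro rfl; omega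
  rw [Matrix.sub_apply, Matrix.one_apply_ne huv, sub_zero]
  exact dif_neg fun hadj : u.val + 1 = v.val => by omega

/-- The concentration matrix of the chain is tridiagonal. -/
lemma chain_concentration_of_lt (a : (chain p).Edge → ℝ) {u v : Fin p} (h : u.val + 1 < v.val) :
    (chain p).concentration a u v = 0 := by
  rw [concentration, Matrix.mul_apply]
  refine Finset.sum_eq_zero fun w _ => ?_
  rw [Matrix.transpose_apply]
  rcases lt_or_ge w v with hw | hw
  · rw [weightMatrix_sub_one_of_lt _ a hw, mul_zero]
  · rw [chain_weightMatrix_sub_one a (lt_of_lt_of_le h hw), zero_mul]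

lemma chain_concentration_edge (a : (chain p).Edge → ℝ) (e : (chain p).Edge) :
    (chain p).concentration a e.1.1 e.1.2 = -a e := by
  obtain ⟨⟨u, v⟩, huv⟩ := e
  have huv' : u.val + 1 = v.val := huv
  have hne : u ≠ v := by rintro rfl; omega
  rw [concentration, Matrix.mul_apply, Finset.sum_eq_single v]
  · rw [Matrix.transpose_apply, Matrix.sub_apply, Matrix.sub_apply, Matrix.one_apply_ne hne,
      Matrix.one_apply_eq, weightMatrix_of_le _ a le_rfl, weightMatrix, Matrix.of_apply,
      dif_pos huv]
    ring
  · intro w _ hw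
    rw [Matrix.transpose_apply]
    rcases lt_or_gt_of_ne hw with hw | hw
    · rw [weightMatrix_sub_one_of_lt _ a hw, mul_zero]
    · rw [chain_weightMatrix_sub_one a (huv'.trans_lt hw), zero_mul]
  · simp

/-- The edges of the path from `i` to `j` in the chain. -/
def chainPath (i j : Fin p) : Finset (chain p).Edge :=
  Finset.univ.map ⟨fun k : Fin (j.val - i.val) =>
    (⟨(⟨i.val + k, by omega⟩, ⟨i.val + k + 1, by omega⟩), rfl⟩ : (chain p).Edge), fun k l h => by
      have := congrArg (fun e : (chain p).Edge => e.1.1.val) h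
      exact Fin.ext (by simpa using this)⟩

lemma card_chainPath (i j : Fin p) : (chainPath i j).card = j.val - i.val := by
  rw [chainPath, Finset.card_map, Finset.card_univ, Fintype.card_fin]

/-- A conditioned vertex `s` between `i` and `j` separates them: the rows of `K_{iR, jR}` before `s`
are supported on the columns before `s`, and there is one column less of these. -/
lemma chain_dSeparated_of_between {i j s : Fin p} {S : Finset (Fin p)} (hs : s ∈ S) (his : i < s)
    (hsj : s < j) : (chain p).DSeparated i j S := by
  intro a
  set R := rest i j S
  have hsR : s ∉ R := fun h => (mem_rest.1 h).1 hs
  let row : Option R → Fin p := fun o => o.elim i Subtype.val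
  let col : Option R → Fin p := fun o => o.elim j Subtype.val
  change (((chain p).concentration a).submatrix row col).det = 0
  rw [Matrix.det_apply]
  refine Finset.sum_eq_zero fun σ _ => ?_
  obtain ⟨o, ho₁, ho₂⟩ : ∃ o, row (σ o) < s ∧ s ≤ col o := by
    by_contra! hcon
    have h1 : (Finset.univ.filter fun o => row (σ o) < s).card
        = (Finset.univ.filter fun o => row o < s).card := by
      refine Finset.card_equiv σ fun o => ?_
      simp
    have h2 : (Finset.univ.filter fun o => row (σ o) < s).card
        ≤ (Finset.univ.filter fun o => col o < s).card :=
      Finset.card_le_card (Finset.monotone_filter_right _ fun o _ ho => hcon o ho)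
    have h3 : (Finset.univ.filter fun o => col o < s).card
        < (Finset.univ.filter fun o => row o < s).card := by
      refine Finset.card_lt_card (Finset.ssubset_iff_subset_ne.2 ⟨?_, fun h => ?_⟩)
      · rintro (_ | u) hu
        · simpa [row] using his
        · simpa [row, col] using hu
      · have : none ∈ Finset.univ.filter fun o => col o < s := by
          rw [h]; simpa [row] using his
        exact absurd (by simpa [col] using this) hsj.not_gt
    omega
  have hlt : s < col o := by
    refine lt_of_le_of_ne ho₂ fun h => ?_
    rcases o with _ | u
    · exact hsj.ne h
    · exact hsR (h ▸ u.2)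
  have hz : ((chain p).concentration a).submatrix row col (σ o) o = 0 :=
    chain_concentration_of_lt a (show (row (σ o)).val + 1 < (col o).val by
      have h1 : (row (σ o)).val < s.val := ho₁
      have h2 : s.val < (col o).val := hlt
      omega)
  rw [Finset.prod_eq_zero (f := fun o => ((chain p).concentration a).submatrix row col (σ o) o)
    (Finset.mem_univ o) hz, smul_zero]

/-- If no vertex between `i` and `j` is conditioned upon, then `K_{iR, jR}` is block triangular, and
the block of the path from `i` to `j` is triangular with the negative edge weights on its
diagonal. -/
lemma chain_abs_minor {i j : Fin p} (hij : i < j) {R : Finset (Fin p)} (hi : i ∉ R) (hj : j ∉ R)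
    (hR : ∀ u, i < u → u < j → u ∈ R) :
    ∃ q : ((chain p).Edge → ℝ) → ℝ, Continuous q ∧ (∀ a, 0 < q a) ∧ q 0 = 1 ∧
      ∀ a, |minor ((chain p).concentration a) i j R| = q a * absProd (chainPath i j) a := by
  have hij' : i.val < j.val := hij
  -- Rows: the part of `R` before `i`, then `i, …, j - 1`, then the part of `R` after `j`. In the
  -- columns the path is shifted by one, to `i + 1, …, j`.
  let lo : {u : Fin p // u ∈ R ∧ u < i} → Fin p := Subtype.val
  let hi' : {u : Fin p // u ∈ R ∧ j < u} → Fin p := Subtype.val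
  let src : Fin (j.val - i.val) → Fin p := fun k => ⟨i.val + k, by omega⟩
  let tgt : Fin (j.val - i.val) → Fin p := fun k => ⟨i.val + k + 1, by omega⟩
  have hlo : Function.Injective lo := Subtype.val_injective
  have hhi : Function.Injective hi' := Subtype.val_injective
  let f := Sum.elim lo (Sum.elim src hi')
  let g := Sum.elim lo (Sum.elim tgt hi')
  have hf : Function.Injective f := by
    refine hlo.sumElim (Function.Injective.sumElim ?_ hhi ?_) ?_
    · intro k l h
      exact Fin.ext (by simpa [src] using h)
    · rintro k ⟨u, hu, hju⟩ h
      have : i.val + k = u.val := congrArg Fin.val h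
      have : j.val < u.val := hju
      omega
    · rintro ⟨u, hu, hui⟩ (k | ⟨v, hv, hjv⟩) h
      · have : u.val = i.val + k := congrArg Fin.val h
        have : u.val < i.val := hui
        omega
      · have : u.val = v.val := congrArg Fin.val h
        have : u.val < i.val := hui
        have : j.val < v.val := hjv
        omega
  have hg : Function.Injective g := by
    refine hlo.sumElim (Function.Injective.sumElim ?_ hhi ?_) ?_
    · intro k l h
      exact Fin.ext (by simpa [tgt] using h)
    · rintro k ⟨u, hu, hju⟩ h
      have : i.val + k + 1 = u.val := congrArg Fin.val h
      have : j.val < u.val := hju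
      omega
    · rintro ⟨u, hu, hui⟩ (k | ⟨v, hv, hjv⟩) h
      · have : u.val = i.val + k + 1 := congrArg Fin.val h
        have : u.val < i.val := hui
        omega
      · have : u.val = v.val := congrArg Fin.val h
        have : u.val < i.val := hui
        have : j.val < v.val := hjv
        omega
  have hfr : Set.range f = insert i (R : Set (Fin p)) := by
    refine Set.Subset.antisymm ?_ ?_
    · rintro _ ⟨⟨u, hu, -⟩ | k | ⟨u, hu, -⟩, rfl⟩
      · exact Or.inr hu
      · rcases Nat.eq_zero_or_pos k.val with hk | hk
        · exact Or.inl (Fin.ext (by simp [f, src, hk]))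
        · refine Or.inr (hR _ ?_ ?_)
          · change i.val < i.val + k; omega
          · change i.val + k < j.val; omega
      · exact Or.inr hu
    · rintro u (rfl | hu)
      · exact ⟨Sum.inr (Sum.inl ⟨0, by omega⟩), Fin.ext (by simp [f, src])⟩
      · have hu : u ∈ R := hu
        rcases lt_trichotomy u i with h | rfl | h
        · exact ⟨Sum.inl ⟨u, hu, h⟩, rfl⟩
        · exact absurd hu hi
        · have h' : i.val < u.val := h
          rcases lt_trichotomy u j with h1 | rfl | h1
          · have h1' : u.val < j.val := h1
            refine ⟨Sum.inr (Sum.inl ⟨u.val - i.val, by omega⟩), Fin.ext ?_⟩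
            change i.val + (u.val - i.val) = u.val
            omega
          · exact absurd hu hj
          · exact ⟨Sum.inr (Sum.inr ⟨u, hu, h1⟩), rfl⟩
  have hgr : Set.range g = insert j (R : Set (Fin p)) := by
    refine Set.Subset.antisymm ?_ ?_
    · rintro _ ⟨⟨u, hu, -⟩ | k | ⟨u, hu, -⟩, rfl⟩
      · exact Or.inr hu
      · by_cases hk : i.val + k + 1 = j.val
        · exact Or.inl (Fin.ext hk)
        · refine Or.inr (hR _ ?_ ?_)
          · change i.val < i.val + k + 1; omega
          · change i.val + k + 1 < j.val; omega
      · exact Or.inr hu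
    · rintro u (rfl | hu)
      · refine ⟨Sum.inr (Sum.inl ⟨u.val - i.val - 1, by omega⟩), Fin.ext ?_⟩
        change i.val + (u.val - i.val - 1) + 1 = u.val
        omega
      · have hu : u ∈ R := hu
        rcases lt_trichotomy u i with h | rfl | h
        · exact ⟨Sum.inl ⟨u, hu, h⟩, rfl⟩
        · exact absurd hu hi
        · have h' : i.val < u.val := h
          rcases lt_trichotomy u j with h1 | rfl | h1
          · have h1' : u.val < j.val := h1
            refine ⟨Sum.inr (Sum.inl ⟨u.val - i.val - 1, by omega⟩), Fin.ext ?_⟩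
            change i.val + (u.val - i.val - 1) + 1 = u.val
            omega
          · exact absurd hu hj
          · exact ⟨Sum.inr (Sum.inr ⟨u, hu, h1⟩), rfl⟩
  have hK := fun a => (chain p).concentration_posDef a
  refine ⟨fun a => (((chain p).concentration a).submatrix lo lo).det *
    (((chain p).concentration a).submatrix hi' hi').det, ?_, ?_, ?_, ?_⟩
  · exact ((continuous_concentration _).matrix_submatrix _ _).matrix_det.mul
      ((continuous_concentration _).matrix_submatrix _ _).matrix_det
  · exact fun a => mul_pos ((hK a).submatrix hlo).det_pos ((hK a).submatrix hhi).det_pos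
  · simp only [concentration_zero, Matrix.submatrix_one _ hlo, Matrix.submatrix_one _ hhi,
      Matrix.det_one, mul_one]
  · intro a
    set K := (chain p).concentration a
    have hblock : K.submatrix f g = Matrix.fromBlocks (K.submatrix lo lo) 0
        (K.submatrix (Sum.elim src hi') lo) (Matrix.fromBlocks (K.submatrix src tgt) 0
          (K.submatrix hi' tgt) (K.submatrix hi' hi')) := by
      ext (⟨u, hu, hui⟩ | k | ⟨u, hu, hju⟩) (⟨v, hv, hvi⟩ | l | ⟨v, hv, hjv⟩) <;> try rfl
      · exact chain_concentration_of_lt a (show u.val + 1 < i.val + l + 1 by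
          have : u.val < i.val := hui
          omega)
      · exact chain_concentration_of_lt a (show u.val + 1 < v.val by
          have : u.val < i.val := hui
          have : j.val < v.val := hjv
          omega)
      · exact chain_concentration_of_lt a (show i.val + k + 1 < v.val by
          have : j.val < v.val := hjv
          omega)
    have hmid : (K.submatrix src tgt).det = ∏ k, K (src k) (tgt k) := by
      refine Matrix.det_of_isLowerTriangular _ fun k l hkl => ?_
      have hkl : k.val < l.val := hkl
      exact chain_concentration_of_lt a (show i.val + k + 1 < i.val + l + 1 by omega)
    have hprod : |∏ k, K (src k) (tgt k)| = absProd (chainPath i j) a := by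
      rw [absProd, chainPath, Finset.prod_map, Finset.abs_prod]
      refine Finset.prod_congr rfl fun k _ => ?_
      have := chain_concentration_edge a ⟨(src k, tgt k), rfl⟩
      exact (congrArg abs this).trans (abs_neg _)
    rw [abs_minor_eq K hi hj hf hg hfr hgr, hblock, Matrix.det_fromBlocks_zero₁₂,
      Matrix.det_fromBlocks_zero₁₂, hmid, abs_mul, abs_mul, hprod,
      abs_of_pos ((hK a).submatrix hlo).det_pos, abs_of_pos ((hK a).submatrix hhi).det_pos]
    ring

/-- The path between the two ends consists of all edges. -/
lemma chainPath_ends {i j : Fin p} (hi : i.val = 0) (hj : j.val + 1 = p) :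
    chainPath i j = Finset.univ := by
  refine Finset.eq_univ_of_forall fun e => ?_
  obtain ⟨⟨u, v⟩, huv⟩ := e
  have huv' : u.val + 1 = v.val := huv
  refine Finset.mem_map.2 ⟨⟨u.val, by omega⟩, Finset.mem_univ _, ?_⟩
  refine Subtype.ext (Prod.ext (Fin.ext ?_) (Fin.ext ?_))
  · change i.val + u.val = u.val; omega
  · change i.val + u.val + 1 = v.val; omega

lemma chain_mem_rest_of_not_dSeparated {i j : Fin p} {S : Finset (Fin p)}
    (hd : ¬ (chain p).DSeparated i j S) (u : Fin p) (hiu : i < u) (huj : u < j) :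
    u ∈ rest i j S :=
  mem_rest.2 ⟨fun hu => hd (chain_dSeparated_of_between hu hiu huj), hiu.ne', huj.ne⟩

/-- The tube of a triple that is not d-separated lies in a tube around the product over the path. -/
lemma chain_absProd_le_of_mem_tube (i j : Fin p) (S : Finset (Fin p)) :
    ∃ C, 0 < C ∧ (i < j → ¬ (chain p).DSeparated i j S → ∀ t > 0, ∀ a ∈ (chain p).tube i j S t,
      absProd (chainPath i j) a ≤ C * t) := by
  by_cases h : i < j ∧ ¬ (chain p).DSeparated i j S
  · obtain ⟨q, hqc, hqpos, -, hq⟩ := chain_abs_minor h.1 (left_notMem_rest i j S)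
      (right_notMem_rest i j S) (chain_mem_rest_of_not_dSeparated h.2)
    obtain ⟨C, hC0, hC⟩ := exists_bound (((chain p).continuous_minorScale i j S).div hqc
      fun a => (hqpos a).ne')
    refine ⟨C, hC0, fun _ _ t ht a ha => ?_⟩
    obtain ⟨hcube, hle⟩ := (mem_tube _).1 ha
    rw [hq a, mul_comm, ← le_div_iff₀ (hqpos a), mul_div_assoc] at hle
    rw [mul_comm]
    exact hle.trans (mul_le_mul_of_nonneg_left (hC a hcube) ht.le)
  · exact ⟨1, one_pos, fun h1 h2 => absurd ⟨h1, h2⟩ h⟩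

theorem chain_isEquivalent (hp : 2 ≤ p) :
    (chain p).unfaithfulVolume ~[𝓝[>] (0 : ℝ)]
      fun t : ℝ => (1 / ((p - 2).factorial : ℝ)) * (t * (-Real.log t) ^ (p - 2)) := by
  refine isEquivalent_of_tendsto_div (by positivity) ?_
  simp only [unfaithfulVolume_eq]
  let i₀ : Fin p := ⟨0, by omega⟩
  let j₀ : Fin p := ⟨p - 1, by omega⟩
  have hij₀ : i₀ < j₀ := by rw [Fin.lt_def]; change 0 < p - 1; omega
  have hpath : chainPath i₀ j₀ = Finset.univ :=
    chainPath_ends rfl (by change p - 1 + 1 = p; omega)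
  have hcard : (Finset.univ : Finset (chain p).Edge).card = (p - 2) + 1 := by
    rw [← hpath, card_chainPath]
    change p - 1 - 0 = p - 2 + 1
    omega
  obtain ⟨q, hqc, hqpos, hq0, hq⟩ := chain_abs_minor hij₀ (left_notMem_rest i₀ j₀ ∅)
    (right_notMem_rest i₀ j₀ ∅) (fun u h1 h2 => mem_rest.2 ⟨by simp, h1.ne', h2.ne⟩)
  rw [hpath] at hq
  have htube : ∀ t a, a ∈ (chain p).tube i₀ j₀ ∅ t ↔ a ∈ (chain p).cube ∧
      absProd Finset.univ a ≤ t * ((chain p).minorScale i₀ j₀ ∅ a / q a) := by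
    intro t a
    rw [mem_tube, hq a, mul_comm (q a), ← mul_div_assoc, le_div_iff₀ (hqpos a)]
  -- The minor does not vanish at the point with all weights equal to `1`.
  have hnd : ¬ (chain p).DSeparated i₀ j₀ ∅ := fun h => by
    have h1 := hq fun _ => 1
    rw [h] at h1
    exact (hqpos _).ne (by simpa [absProd] using h1)
  choose C hC0 hC using fun T : Fin p × Fin p × Finset (Fin p) =>
    chain_absProd_le_of_mem_tube T.1 T.2.1 T.2.2
  have key := tendsto_measureReal_region (m := p - 2) {Finset.univ} (by simpa using hcard)
    (h := fun _ a => (chain p).minorScale i₀ j₀ ∅ a / q a)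
    (fun _ => ((chain p).continuous_minorScale i₀ j₀ ∅).div hqc fun a => (hqpos a).ne')
    (fun _ a => div_pos ((chain p).minorScale_pos i₀ j₀ ∅ a) (hqpos a))
    (U := (chain p).unfaithfulRegion) (C := ∑ T, C T)
    (Finset.sum_pos (fun T _ => hC0 T) ⟨(i₀, j₀, ∅), Finset.mem_univ _⟩) ?_ ?_
  · have hz : ∀ a : (chain p).Edge → ℝ, zeroOn Finset.univ a = 0 := fun a => by
      ext e; simp [zeroOn]
    simpa [hz, minorScale_zero, hq0, logScale] using key
  · intro t _ a ha s hs hle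
    rw [Finset.mem_singleton.1 hs] at hle
    exact (mem_unfaithfulRegion _).2 ⟨i₀, j₀, ∅, hij₀, by simp, by simp, hnd,
      (htube t a).2 ⟨ha, hle⟩⟩
  · intro t ht a ha hU
    obtain ⟨i, j, S, hij, hi, hj, hd, hmem⟩ := (mem_unfaithfulRegion _).1 hU
    have hij' : i.val < j.val := hij
    by_cases hends : i = i₀ ∧ j = j₀
    · obtain ⟨rfl, rfl⟩ := hends
      left
      have hS : S = ∅ := by
        refine Finset.eq_empty_of_forall_notMem fun u hu => ?_
        have hui : u ≠ i₀ := fun h => hi (h ▸ hu)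
        have huj : u ≠ j₀ := fun h => hj (h ▸ hu)
        have hui' : u.val ≠ 0 := fun h => hui (Fin.ext h)
        have huj' : u.val ≠ p - 1 := fun h => huj (Fin.ext h)
        refine (mem_rest.1 (chain_mem_rest_of_not_dSeparated hd u ?_ ?_)).1 hu
        · change 0 < u.val; omega
        · change u.val < p - 1; omega
      subst hS
      exact ⟨Finset.univ, Finset.mem_singleton_self _, ((htube t a).1 hmem).2⟩
    · right
      refine ⟨chainPath i j, ?_, (hC (i, j, S) hij hd t ht a hmem).trans ?_⟩
      · rw [card_chainPath]
        by_contra hcon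
        have hi0 : i.val = 0 := by omega
        have hj0 : j.val = p - 1 := by omega
        exact hends ⟨Fin.ext hi0, Fin.ext hj0⟩
      · exact mul_le_mul_of_nonneg_right (Finset.single_le_sum (fun T _ => (hC0 T).le)
          (Finset.mem_univ (i, j, S))) ht.le

/-! ### The star -/

lemma star_weightMatrix_edge (a : (star p).Edge → ℝ) (e : (star p).Edge) :
    (star p).weightMatrix a e.1.1 e.1.2 = a e :=
  dif_pos e.2

lemma star_weightMatrix_sub_one (a : (star p).Edge → ℝ) {u : Fin p} (hu : u.val ≠ 0) (v : Fin p) :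
    ((star p).weightMatrix a - 1) u v = -(1 : Matrix (Fin p) (Fin p) ℝ) u v := by
  rw [Matrix.sub_apply, weightMatrix, Matrix.of_apply, dif_neg fun h => hu h.1, zero_sub]

lemma star_concentration_leaf (a : (star p).Edge → ℝ) (u : Fin p) {v : Fin p} (hv : v.val ≠ 0) :
    (star p).concentration a u v
      = (1 : Matrix (Fin p) (Fin p) ℝ) u v - (star p).weightMatrix a u v := by
  rw [concentration, Matrix.mul_apply, Finset.sum_eq_single v]
  · rw [Matrix.transpose_apply, star_weightMatrix_sub_one a hv, Matrix.one_apply_eq,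
      Matrix.sub_apply]
    ring
  · intro w _ hw
    rw [Matrix.transpose_apply, star_weightMatrix_sub_one a hv, Matrix.one_apply_ne hw.symm,
      neg_zero, mul_zero]
  · simp

lemma star_concentration_leaf_leaf (a : (star p).Edge → ℝ) {u v : Fin p} (hu : u.val ≠ 0)
    (hv : v.val ≠ 0) : (star p).concentration a u v = (1 : Matrix (Fin p) (Fin p) ℝ) u v := by
  rw [star_concentration_leaf a u hv, weightMatrix, Matrix.of_apply, dif_neg fun h => hu h.1,
    sub_zero]

lemma star_concentration_center_leaf (a : (star p).Edge → ℝ) {c v : Fin p} (hc : c.val = 0)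
    (hv : v.val ≠ 0) : (star p).concentration a c v = -(star p).weightMatrix a c v := by
  have hne : c ≠ v := by rintro rfl; exact hv hc
  rw [star_concentration_leaf a c hv, Matrix.one_apply_ne hne, zero_sub]

lemma sum_star_weightMatrix_sq (a : (star p).Edge → ℝ) {c : Fin p} (hc : c.val = 0) :
    ∑ v, (star p).weightMatrix a c v ^ 2 = ∑ e, a e ^ 2 := by
  have he : ∀ e : (star p).Edge, e.1.1 = c := fun e => Fin.ext (e.2.1.trans hc.symm)
  symm
  refine Finset.sum_of_injOn (fun e => e.1.2) ?_ (fun _ _ => Finset.mem_coe.2 (Finset.mem_univ _))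
    ?_ ?_
  · intro e _ e' _ h
    exact Subtype.ext (Prod.ext ((he e).trans (he e').symm) h)
  · intro v _ hv
    have : ¬ (star p).Adj c v := fun h =>
      hv ⟨⟨(c, v), h⟩, Finset.mem_coe.2 (Finset.mem_univ _), rfl⟩
    rw [weightMatrix, Matrix.of_apply, dif_neg this, zero_pow two_ne_zero]
  · intro e _
    rw [← he e, star_weightMatrix_edge]

lemma star_concentration_center (a : (star p).Edge → ℝ) {c : Fin p} (hc : c.val = 0) :
    (star p).concentration a c c = 1 + ∑ e, a e ^ 2 := by
  have h : ∀ w, ((star p).weightMatrix a - 1) c w * ((star p).weightMatrix a - 1) c w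
      = (star p).weightMatrix a c w ^ 2 + if w = c then 1 else 0 := by
    intro w
    rw [Matrix.sub_apply]
    by_cases hw : w = c
    · subst hw
      rw [weightMatrix_of_le _ a le_rfl, Matrix.one_apply_eq, if_pos rfl]
      ring
    · rw [Matrix.one_apply_ne (Ne.symm hw), if_neg hw]
      ring
  rw [concentration, Matrix.mul_apply]
  simp only [Matrix.transpose_apply, h]
  rw [Finset.sum_add_distrib, sum_star_weightMatrix_sq a hc, Finset.sum_ite_eq', if_pos (by simp),
    add_comm]

/-- If the centre is conditioned upon, then it separates the leaves. -/
lemma star_dSeparated {c i j : Fin p} {S : Finset (Fin p)} (hc : c.val = 0) (hcS : c ∈ S)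
    (hi : i.val ≠ 0) (hj : j.val ≠ 0) (hij : i ≠ j) : (star p).DSeparated i j S := by
  intro a
  refine Matrix.det_eq_zero_of_row_eq_zero none ?_
  rintro (_ | ⟨u, hu⟩)
  · exact (star_concentration_leaf_leaf a hi hj).trans (Matrix.one_apply_ne hij)
  · obtain ⟨huS, hui, -⟩ := mem_rest.1 hu
    have hu0 : u.val ≠ 0 := fun h => huS ((Fin.ext (h.trans hc.symm) : u = c) ▸ hcS)
    exact (star_concentration_leaf_leaf a hi hu0).trans (Matrix.one_apply_ne hui.symm)

/-- The minor of the centre and a leaf. -/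
lemma star_abs_minor_center (a : (star p).Edge → ℝ) {c j : Fin p} {R : Finset (Fin p)}
    (hc : c.val = 0) (hj : j.val ≠ 0) (hcR : c ∉ R) (hjR : j ∉ R) :
    |minor ((star p).concentration a) c j R| = |(star p).weightMatrix a c j| := by
  have hR : ∀ u ∈ R, u.val ≠ 0 := fun u hu h => hcR ((Fin.ext (h.trans hc.symm) : u = c) ▸ hu)
  have hrange : ∀ i : Fin p, Set.range (Sum.elim (fun _ : Unit => i) (Subtype.val : R → Fin p))
      = insert i (R : Set (Fin p)) := fun i => by
    rw [Set.Sum.elim_range, Set.range_const, Subtype.range_coe, Set.singleton_union]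
  have hinj : ∀ i : Fin p, i ∉ R →
      Function.Injective (Sum.elim (fun _ : Unit => i) (Subtype.val : R → Fin p)) := fun i hi =>
    (Function.injective_of_subsingleton _).sumElim Subtype.val_injective
      fun _ u h => hi (h ▸ u.2)
  set K := (star p).concentration a with hK
  have hblock : K.submatrix (Sum.elim (fun _ : Unit => c) (Subtype.val : R → Fin p))
      (Sum.elim (fun _ : Unit => j) (Subtype.val : R → Fin p)) = Matrix.fromBlocks
        (Matrix.of fun _ _ => K c j) (Matrix.of fun _ u => K c u.1) 0 1 := by
    ext (_ | ⟨u, hu⟩) (_ | ⟨v, hv⟩)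
    · rfl
    · rfl
    · exact (star_concentration_leaf_leaf a (hR u hu) hj).trans
        (Matrix.one_apply_ne fun h => hjR (h ▸ hu))
    · refine (star_concentration_leaf_leaf a (hR u hu) (hR v hv)).trans ?_
      simp [Matrix.one_apply]
  rw [abs_minor_eq K hcR hjR (hinj c hcR) (hinj j hjR) (hrange c) (hrange j), hblock,
    Matrix.det_fromBlocks_zero₂₁, Matrix.det_one, mul_one, Matrix.det_unique, Matrix.of_apply, hK,
    star_concentration_center_leaf a hc hj, abs_neg]

/-- The minor of two leaves, which may agree, is the determinant of the Schur complement of the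
identity block of the other leaves. -/
lemma star_abs_minor_leaf (a : (star p).Edge → ℝ) {c i j : Fin p} {R : Finset (Fin p)}
    (hc : c.val = 0) (hi : i.val ≠ 0) (hj : j.val ≠ 0) (hcR : c ∈ R) (hiR : i ∉ R) (hjR : j ∉ R) :
    |minor ((star p).concentration a) i j R| =
      |(1 : Matrix (Fin p) (Fin p) ℝ) i j *
          (1 + ∑ e, a e ^ 2 - ∑ u ∈ R, (star p).weightMatrix a c u ^ 2) -
        (star p).weightMatrix a c i * (star p).weightMatrix a c j| := by
  have hR : ∀ u ∈ R.erase c, u.val ≠ 0 := fun u hu h =>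
    Finset.ne_of_mem_erase hu (Fin.ext (h.trans hc.symm))
  have hrange : ∀ i : Fin p, Set.range (Sum.elim ![i, c] (Subtype.val : R.erase c → Fin p))
      = insert i (R : Set (Fin p)) := fun i => by
    rw [Set.Sum.elim_range, Matrix.range_cons, Matrix.range_cons, Matrix.range_empty,
      Subtype.range_coe, Set.union_empty, Set.union_assoc, Set.singleton_union,
      Set.singleton_union, Finset.coe_erase, Set.insert_sdiff_singleton, Set.insert_eq_of_mem
      (Finset.mem_coe.2 hcR)]
  have hinj : ∀ i : Fin p, i ∉ R →
      Function.Injective (Sum.elim ![i, c] (Subtype.val : R.erase c → Fin p)) := by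
    intro i hi
    have hic : i ≠ c := fun h => hi (h ▸ hcR)
    refine Function.Injective.sumElim ?_ Subtype.val_injective ?_
    · intro k l h
      fin_cases k <;> fin_cases l <;> simp_all
    · rintro k ⟨u, hu⟩ h
      have hu' := Finset.mem_erase.1 hu
      fin_cases k
      · exact hi ((show i = u from h) ▸ hu'.2)
      · exact hu'.1 (show c = u from h).symm
  set K := (star p).concentration a with hK
  set x := (star p).weightMatrix a c with hx
  have hcu : ∀ {u : Fin p}, u.val ≠ 0 → K c u = -x u := fun hu =>
    star_concentration_center_leaf a hc hu
  have huc : ∀ {u : Fin p}, u.val ≠ 0 → K u c = -x u := fun hu => by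
    rw [hK, concentration_comm]; exact hcu hu
  have hblock : K.submatrix (Sum.elim ![i, c] (Subtype.val : R.erase c → Fin p))
      (Sum.elim ![j, c] (Subtype.val : R.erase c → Fin p)) = Matrix.fromBlocks
        !![(1 : Matrix (Fin p) (Fin p) ℝ) i j, -x i; -x j, 1 + ∑ e, a e ^ 2]
        (Matrix.of ![fun _ => 0, fun u : R.erase c => -x u.1])
        (Matrix.of fun u : R.erase c => ![0, -x u.1]) 1 := by
    ext (k | ⟨u, hu⟩) (l | ⟨v, hv⟩)
    · fin_cases k <;> fin_cases l
      · exact star_concentration_leaf_leaf a hi hj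
      · exact huc hi
      · exact hcu hj
      · exact star_concentration_center a hc
    · fin_cases k
      · exact (star_concentration_leaf_leaf a hi (hR v hv)).trans
          (Matrix.one_apply_ne fun h => hiR (h ▸ Finset.mem_of_mem_erase hv))
      · exact hcu (hR v hv)
    · fin_cases l
      · exact (star_concentration_leaf_leaf a (hR u hu) hj).trans
          (Matrix.one_apply_ne fun h => hjR (h ▸ Finset.mem_of_mem_erase hu))
      · exact huc (hR u hu)
    · refine (star_concentration_leaf_leaf a (hR u hu) (hR v hv)).trans ?_
      simp [Matrix.one_apply]
  have hsum : ∑ u ∈ (R.erase c).attach, x u * x u = ∑ u ∈ R, x u ^ 2 := by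
    rw [Finset.sum_attach (R.erase c) fun u => x u * x u, ← Finset.add_sum_erase R _ hcR]
    have : x c = 0 := weightMatrix_of_le _ a le_rfl
    simp [this, sq]
  rw [abs_minor_eq K hiR hjR (hinj i hiR) (hinj j hjR) (hrange i) (hrange j), hblock,
    Matrix.det_fromBlocks_one₂₂, Matrix.det_fin_two]
  congr 1
  simp [Matrix.vecMul, dotProduct, hsum]

/-- The principal minor of a leaf `i` and of `R`, which contains the centre, equals
`1 + ∑ (a u)²`, summed over the leaves `u` outside `R ∪ {i}`. -/
lemma star_minor_self (a : (star p).Edge → ℝ) {c i : Fin p} {R : Finset (Fin p)}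
    (hc : c.val = 0) (hi : i.val ≠ 0) (hcR : c ∈ R) (hiR : i ∉ R) :
    minor ((star p).concentration a) i i R =
      1 + ∑ e, a e ^ 2 - ∑ u ∈ insert i R, (star p).weightMatrix a c u ^ 2 := by
  have h := star_abs_minor_leaf a hc hi hi hcR hiR hiR
  have hle : ∑ u ∈ insert i R, (star p).weightMatrix a c u ^ 2 ≤ ∑ e, a e ^ 2 := by
    rw [← sum_star_weightMatrix_sq a hc]
    exact Finset.sum_le_sum_of_subset_of_nonneg (Finset.subset_univ _) fun _ _ _ => sq_nonneg _
  have he : (1 : Matrix (Fin p) (Fin p) ℝ) i i *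
        (1 + ∑ e, a e ^ 2 - ∑ u ∈ R, (star p).weightMatrix a c u ^ 2) -
        (star p).weightMatrix a c i * (star p).weightMatrix a c i
      = 1 + ∑ e, a e ^ 2 - ∑ u ∈ insert i R, (star p).weightMatrix a c u ^ 2 := by
    rw [Finset.sum_insert hiR, Matrix.one_apply_eq]
    ring
  rwa [he, abs_of_pos (minor_self_pos _ a hiR), abs_of_pos (by linarith)] at h

/-- The threshold of the largest of the tubes of two leaves of the star, as a function of the pair
of edges. It is attained when one conditions on all other leaves. -/
noncomputable def starScale (s : Finset (star p).Edge) (a : (star p).Edge → ℝ) : ℝ :=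
  √(∏ e ∈ s, (1 + ∑ e', a e' ^ 2 - a e ^ 2))

lemma continuous_starScale (s : Finset (star p).Edge) : Continuous (starScale s) := by
  unfold starScale; fun_prop

lemma starScale_pos (s : Finset (star p).Edge) (a : (star p).Edge → ℝ) : 0 < starScale s a := by
  refine Real.sqrt_pos.2 (Finset.prod_pos fun e _ => ?_)
  have := Finset.single_le_sum (f := fun e => a e ^ 2) (fun e _ => sq_nonneg (a e))
    (Finset.mem_univ e)
  linarith

lemma star_edge_fst {e : (star p).Edge} {c : Fin p} (hc : c.val = 0) : e.1.1 = c :=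
  Fin.ext (e.2.1.trans hc.symm)

lemma star_edge_snd_ne (e : (star p).Edge) : e.1.2.val ≠ 0 := e.2.2.ne'

lemma star_edge_snd_injective : Function.Injective fun e : (star p).Edge => e.1.2 := fun _ e' h =>
  Subtype.ext (Prod.ext (star_edge_fst e'.2.1) h)

lemma star_minor_self_le (a : (star p).Edge → ℝ) {c : Fin p} {e : (star p).Edge}
    {R : Finset (Fin p)} (hc : c.val = 0) (hcR : c ∈ R) (heR : e.1.2 ∉ R) :
    minor ((star p).concentration a) e.1.2 e.1.2 R ≤ 1 + ∑ e', a e' ^ 2 - a e ^ 2 := by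
  rw [star_minor_self a hc (star_edge_snd_ne e) hcR heR, Finset.sum_insert heR,
    ← star_edge_fst (e := e) hc, star_weightMatrix_edge]
  have : 0 ≤ ∑ u ∈ R, (star p).weightMatrix a e.1.1 u ^ 2 :=
    Finset.sum_nonneg fun _ _ => sq_nonneg _
  linarith

/-- The bound of `star_minor_self_le` is attained for `R = {c}`, where `c` is the centre. -/
lemma star_minor_self_singleton (a : (star p).Edge → ℝ) {c : Fin p} {e : (star p).Edge}
    (hc : c.val = 0) :
    minor ((star p).concentration a) e.1.2 e.1.2 {c} = 1 + ∑ e', a e' ^ 2 - a e ^ 2 := by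
  have heR : e.1.2 ∉ ({c} : Finset (Fin p)) := fun h =>
    star_edge_snd_ne e ((congrArg Fin.val (Finset.mem_singleton.1 h)).trans hc)
  rw [star_minor_self a hc (star_edge_snd_ne e) (Finset.mem_singleton_self c) heR,
    Finset.sum_insert heR, Finset.sum_singleton, weightMatrix_of_le _ a le_rfl,
    ← star_edge_fst (e := e) hc, star_weightMatrix_edge]
  ring

lemma star_abs_minor_edges [DecidableEq (star p).Edge] (a : (star p).Edge → ℝ) {c : Fin p}
    {e e' : (star p).Edge} {R : Finset (Fin p)} (hne : e ≠ e') (hc : c.val = 0) (hcR : c ∈ R)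
    (heR : e.1.2 ∉ R) (heR' : e'.1.2 ∉ R) :
    |minor ((star p).concentration a) e.1.2 e'.1.2 R| = absProd {e, e'} a := by
  have hx : ∀ e : (star p).Edge, (star p).weightMatrix a c e.1.2 = a e := fun e => by
    rw [← star_edge_fst (e := e) hc, star_weightMatrix_edge]
  rw [star_abs_minor_leaf a hc (star_edge_snd_ne e) (star_edge_snd_ne e') hcR heR heR',
    Matrix.one_apply_ne (star_edge_snd_injective.ne hne), hx, hx, absProd, Finset.prod_pair hne]
  rw [zero_mul, zero_sub, abs_neg, abs_mul]

/-- Among the tubes of two given leaves, the one for the largest conditioning set is the largest. -/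
lemma star_absProd_le_of_mem_tube [DecidableEq (star p).Edge] {a : (star p).Edge → ℝ}
    {c : Fin p} {e e' : (star p).Edge} {S : Finset (Fin p)} {t : ℝ} (ht : 0 < t) (hne : e ≠ e')
    (hc : c.val = 0) (hcS : c ∉ S) (ha : a ∈ (star p).tube e.1.2 e'.1.2 S t) :
    absProd {e, e'} a ≤ t * starScale {e, e'} a := by
  have hce : ∀ e : (star p).Edge, c ≠ e.1.2 := fun e h =>
    star_edge_snd_ne e ((congrArg Fin.val h).symm.trans hc)
  have hcR : c ∈ rest e.1.2 e'.1.2 S := mem_rest.2 ⟨hcS, hce e, hce e'⟩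
  have heR := left_notMem_rest e.1.2 e'.1.2 S
  have heR' := right_notMem_rest e.1.2 e'.1.2 S
  have h := ((mem_tube _).1 ha).2
  rw [star_abs_minor_edges a hne hc hcR heR heR'] at h
  refine h.trans (mul_le_mul_of_nonneg_left ?_ ht.le)
  rw [minorScale, starScale, Finset.prod_pair hne]
  exact Real.sqrt_le_sqrt (mul_le_mul (star_minor_self_le a hc hcR heR)
    (star_minor_self_le a hc hcR heR') (minor_self_pos _ a heR').le
    ((minor_self_pos _ a heR).le.trans (star_minor_self_le a hc hcR heR)))

lemma star_mem_tube_iff [DecidableEq (star p).Edge] {a : (star p).Edge → ℝ}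
    {c : Fin p} {e e' : (star p).Edge} {S : Finset (Fin p)} {t : ℝ} (hne : e ≠ e')
    (hc : c.val = 0) (hS : rest e.1.2 e'.1.2 S = {c}) :
    a ∈ (star p).tube e.1.2 e'.1.2 S t ↔
      a ∈ (star p).cube ∧ absProd {e, e'} a ≤ t * starScale {e, e'} a := by
  have heR := left_notMem_rest e.1.2 e'.1.2 S
  have heR' := right_notMem_rest e.1.2 e'.1.2 S
  rw [mem_tube, star_abs_minor_edges a hne hc (by simp [hS]) heR heR', minorScale, starScale,
    Finset.prod_pair hne, hS, star_minor_self_singleton a hc, star_minor_self_singleton a hc]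

lemma card_star_edge : Fintype.card (star p).Edge = p - 1 := by
  rcases p with _ | n
  · exact Fintype.card_eq_zero_iff.2 ⟨fun e => e.1.1.elim0⟩
  · have h : (Finset.univ : Finset (star (n + 1)).Edge).card
        = ((Finset.univ : Finset (Fin (n + 1))).erase 0).card := by
      refine Finset.card_bij (fun e _ => e.1.2) (fun e _ => ?_)
        (fun e _ e' _ h => star_edge_snd_injective h) fun v hv => ?_
      · exact Finset.mem_erase.2 ⟨fun h => star_edge_snd_ne e (congrArg Fin.val h),
          Finset.mem_univ _⟩
      · exact ⟨⟨(0, v), rfl, Fin.pos_iff_ne_zero.2 (Finset.ne_of_mem_erase hv)⟩,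
          Finset.mem_univ _, rfl⟩
    rw [← Finset.card_univ, h, Finset.card_erase_of_mem (Finset.mem_univ _), Finset.card_univ,
      Fintype.card_fin]

/-- The mean of the threshold `1 + ∑_{e ∉ s} (a e)²`. -/
lemma integral_starScale_zeroOn {s : Finset (star p).Edge} (hp : 3 ≤ p) (hs : s.card = 2) :
    ∫ a, starScale s (zeroOn s a) ∂uniformCube (star p).Edge = p / 3 := by
  classical
  have h : ∀ a : (star p).Edge → ℝ, starScale s (zeroOn s a) = 1 + ∑ e ∈ sᶜ, a e ^ 2 := by
    intro a
    have h1 : ∀ e ∈ s, (1 + ∑ e', zeroOn s a e' ^ 2 - zeroOn s a e ^ 2)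
        = 1 + ∑ e' ∈ sᶜ, a e' ^ 2 := by
      intro e he
      rw [← Finset.sum_add_sum_compl s, Finset.sum_eq_zero (s := s)
        fun e' he' => by simp [zeroOn, he']]
      have h2 : ∀ e' ∈ sᶜ, zeroOn s a e' ^ 2 = a e' ^ 2 := fun e' he' => by
        simp [zeroOn, Finset.mem_compl.1 he']
      rw [Finset.sum_congr rfl h2]
      simp [zeroOn, he]
    rw [starScale, Finset.prod_congr rfl h1, Finset.prod_const, hs, Real.sqrt_sq]
    exact add_nonneg zero_le_one (Finset.sum_nonneg fun _ _ => sq_nonneg _)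
  simp only [h]
  rw [integral_add (integrable_const _) (integrable_finsetSum _ fun e _ =>
      integrable_sq_uniformCube e), integral_finsetSum _ fun e _ => integrable_sq_uniformCube e]
  simp only [integral_sq_uniformCube, Finset.sum_const, Finset.card_compl, hs, card_star_edge,
    integral_const, probReal_univ, nsmul_eq_mul, smul_eq_mul]
  rw [show p - 1 - 2 = p - 3 by omega, Nat.cast_sub hp]
  push_cast
  ring

theorem star_isEquivalent (hp : 3 ≤ p) :
    (star p).unfaithfulVolume ~[𝓝[>] (0 : ℝ)]
      fun t : ℝ => (p.choose 3 : ℝ) * (t * (-Real.log t)) := by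
  classical
  refine isEquivalent_of_tendsto_div
    (Nat.cast_ne_zero.2 (Nat.choose_pos hp).ne') ?_
  simp only [unfaithfulVolume_eq]
  let c : Fin p := ⟨0, by omega⟩
  have hc : c.val = 0 := rfl
  have hce : ∀ e : (star p).Edge, c ≠ e.1.2 := fun e h =>
    star_edge_snd_ne e (congrArg Fin.val h).symm
  let edge : ∀ v : Fin p, v.val ≠ 0 → (star p).Edge := fun v hv =>
    ⟨(c, v), rfl, Nat.pos_of_ne_zero hv⟩
  choose C hC0 hC using fun T : Fin p × Finset (Fin p) =>
    exists_bound ((star p).continuous_minorScale c T.1 T.2)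
  have key := tendsto_measureReal_region (m := 1)
    (Finset.powersetCard 2 (Finset.univ : Finset (star p).Edge))
    (fun s hs => (Finset.mem_powersetCard.1 hs).2) (h := starScale)
    continuous_starScale starScale_pos (U := (star p).unfaithfulRegion) (C := ∑ T, C T)
    (Finset.sum_pos (fun T _ => hC0 T) ⟨(c, ∅), Finset.mem_univ _⟩) ?_ ?_
  · have hsum : ∑ s ∈ Finset.powersetCard 2 (Finset.univ : Finset (star p).Edge),
        (∫ a, starScale s (zeroOn s a) ∂uniformCube (star p).Edge) / ((1 : ℕ).factorial : ℝ)
        = (p.choose 3 : ℝ) := by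
      have h1 : ∀ s ∈ Finset.powersetCard 2 (Finset.univ : Finset (star p).Edge),
          (∫ a, starScale s (zeroOn s a) ∂uniformCube (star p).Edge) / ((1 : ℕ).factorial : ℝ)
          = p / 3 := fun s hs => by
        rw [integral_starScale_zeroOn hp (Finset.mem_powersetCard.1 hs).2, Nat.factorial_one,
          Nat.cast_one, div_one]
      rw [Finset.sum_congr rfl h1, Finset.sum_const, Finset.card_powersetCard, Finset.card_univ,
        card_star_edge, nsmul_eq_mul]
      obtain ⟨n, rfl⟩ : ∃ n, p = n + 1 := ⟨p - 1, by omega⟩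
      have h2 : ((n : ℝ) + 1) * (n.choose 2 : ℝ) = ((n + 1).choose 3 : ℝ) * 3 := by
        exact_mod_cast Nat.add_one_mul_choose_eq n 2
      rw [Nat.add_sub_cancel]
      push_cast
      linarith
    rw [hsum] at key
    simpa [logScale] using key
  · intro t _ a ha s hs hle
    obtain ⟨e, e', hne, rfl⟩ := Finset.card_eq_two.1 (Finset.mem_powersetCard.1 hs).2
    -- Conditioning on all other leaves leaves only the centre in `R`.
    have hS : rest e.1.2 e'.1.2 (Finset.univ \ {c, e.1.2, e'.1.2}) = {c} := by
      ext u
      simp only [mem_rest, Finset.mem_sdiff, Finset.mem_univ, Finset.mem_insert,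
        Finset.mem_singleton, true_and, not_not]
      constructor
      · rintro ⟨h | h | h, h1, h2⟩
        exacts [h, absurd h h1, absurd h h2]
      · rintro rfl
        exact ⟨Or.inl rfl, hce e, hce e'⟩
    refine ⟨e.1.2, e'.1.2, Finset.univ \ {c, e.1.2, e'.1.2}, star_edge_snd_injective.ne hne,
      by simp, by simp, fun hd => ?_, (star_mem_tube_iff hne hc hS).2 ⟨ha, hle⟩⟩
    have h1 := star_abs_minor_edges (fun _ => 1) hne hc (by simp [hS])
      (left_notMem_rest e.1.2 e'.1.2 (Finset.univ \ {c, e.1.2, e'.1.2}))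
      (right_notMem_rest _ _ _)
    rw [hd] at h1
    simp [absProd] at h1
  · intro t ht a ha hU
    obtain ⟨i, j, S, hij, hi, hj, hd, hmem⟩ := (mem_unfaithfulRegion _).1 hU
    have hij' : i.val < j.val := hij
    have hj0 : j.val ≠ 0 := by omega
    by_cases hi0 : i.val = 0
    · obtain rfl : i = c := Fin.ext hi0
      right
      refine ⟨{edge j hj0}, by simp, ?_⟩
      have h := ((mem_tube _).1 hmem).2
      rw [star_abs_minor_center a hc hj0 (left_notMem_rest _ _ _) (right_notMem_rest _ _ _),
        star_weightMatrix_edge a (edge j hj0)] at h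
      rw [absProd, Finset.prod_singleton]
      refine h.trans ?_
      rw [mul_comm]
      exact mul_le_mul_of_nonneg_right ((hC (j, S) a ha).trans
        (Finset.single_le_sum (fun T _ => (hC0 T).le) (Finset.mem_univ (j, S)))) ht.le
    · left
      have hne : edge i hi0 ≠ edge j hj0 := fun h =>
        hij.ne (congrArg (fun e : (star p).Edge => e.1.2) h)
      have hcS : c ∉ S := fun h => hd (star_dSeparated hc h hi0 hj0 hij.ne)
      exact ⟨{edge i hi0, edge j hj0}, Finset.mem_powersetCard.2
        ⟨Finset.subset_univ _, Finset.card_pair hne⟩,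
        star_absProd_le_of_mem_tube ht hne hc hcS hmem⟩

end OrderedDAG

theorem mainTheorem6 (p : ℕ) :
    (2 ≤ p →
      (OrderedDAG.chain p).unfaithfulVolume ~[𝓝[>] (0 : ℝ)]
        fun t : ℝ => (1 / ((p - 2).factorial : ℝ)) * (t * (-Real.log t) ^ (p - 2))) ∧
    (3 ≤ p →
      (OrderedDAG.star p).unfaithfulVolume ~[𝓝[>] (0 : ℝ)]
        fun t : ℝ => (p.choose 3 : ℝ) * (t * (-Real.log t))) :=
  ⟨OrderedDAG.chain_isEquivalent, OrderedDAG.star_isEquivalent⟩
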